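/- \textbf{Theorem 1.} There is a deterministic algorithm (for a unit-cost word RAM with words of $O(\log n)$ bits and zero-initialized memory) that maintains a maximal independent set of a graph on $n$ fixed vertices, starting from the empty graph, under any sequence of edge insertions and deletions (each inserting an absent edge or deleting a present one), in $O(m^{2/3}\sqrt{\log m})$ amortized update time, where $m$ denotes the current (dynamic) number of edges. Precisely: there are a fixed program and a constant $C$ such that, for every $n$, the program initializes in time at most $C(n+1)$, and for every such sequence of updates, presented online, of any length $\ell\ge 0$, at the start and after each update the program holds a maximal independent set of the current graph, stored as an indicator array over the vertices, and the total time spent on the $\ell$ updates is at most $$C\sum_{i=1}^{\ell}\hat m_i^{2/3}\sqrt{\log \hat m_i},\qquad \hat m_i=\max(m_i,2),$$ where $m_i$ is the number of edges of the graph right after the $i$-th update. -/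

import Mathlib

namespace DynMIS

/-! ### A deterministic word RAM with unit-cost instructions

A program is a fixed finite piece of structured code. It works on finitely many registers and
finitely many arrays, whose cells hold words, i.e. natural numbers below a bound `W`. There is no
source of randomness. -/

/-- The contents of the registers and of the arrays: `mem a i` is cell `i` of array `a`. -/
structure State where
  reg : ℕ → ℕ
  mem : ℕ → ℕ → ℕ

/-- The arithmetic and comparison instructions. -/
inductive Op where
  | add | sub | mul | div | lt | eq

/-- The result of an instruction; `sub` is truncated at `0`, `div` rounds down, and comparisons
return `1` (true) or `0` (false). -/
def Op.eval : Op → ℕ → ℕ → ℕ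
  | .add, a, b => a + b
  | .sub, a, b => a - b
  | .mul, a, b => a * b
  | .div, a, b => a / b
  | .lt, a, b => if a < b then 1 else 0
  | .eq, a, b => if a = b then 1 else 0

/-- Expressions: constants, registers, array reads (the array name is fixed in the program text,
the index is computed) and arithmetic. -/
inductive Expr where
  | const (c : ℕ)
  | reg (x : ℕ)
  | load (a : ℕ) (i : Expr)
  | op (o : Op) (e f : Expr)

/-- The value of an expression. -/
def Expr.eval (s : State) : Expr → ℕ
  | .const c => c
  | .reg x => s.reg x
  | .load a i => s.mem a (i.eval s)
  | .op o e f => o.eval (e.eval s) (f.eval s)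

/-- All the values that occur while the expression is evaluated are words, i.e. less than `W`. -/
def Expr.Fits (W : ℕ) (s : State) : Expr → Prop
  | .const c => c < W
  | .reg x => s.reg x < W
  | .load a i => i.Fits W s ∧ s.mem a (i.eval s) < W
  | .op o e f => e.Fits W s ∧ f.Fits W s ∧ o.eval (e.eval s) (f.eval s) < W

/-- The number of instructions used to evaluate an expression. -/
def Expr.cost : Expr → ℕ
  | .const _ => 1
  | .reg _ => 1
  | .load _ i => i.cost + 1
  | .op _ e f => e.cost + f.cost + 1

/-- Program code: assignments to registers and to array cells, sequencing, branching and loops. -/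
inductive Cmd where
  | skip
  | set (x : ℕ) (e : Expr)
  | store (a : ℕ) (i e : Expr)
  | seq (c d : Cmd)
  | cond (e : Expr) (c d : Cmd)
  | loop (e : Expr) (c : Cmd)

/-- Overwrite register `x`. -/
def State.setReg (s : State) (x v : ℕ) : State :=
  { s with reg := Function.update s.reg x v }

/-- Overwrite cell `i` of array `a`. -/
def State.setMem (s : State) (a i v : ℕ) : State :=
  { s with mem := Function.update s.mem a (Function.update (s.mem a) i v) }

/-- `Run W c s s' t`: with words bounded by `W`, the code `c` started in state `s` halts in state
`s'` after `t` steps. Code that produces a number `≥ W` has no run. -/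
inductive Run (W : ℕ) : Cmd → State → State → ℕ → Prop where
  | skip (s : State) : Run W .skip s s 1
  | set (s : State) (x : ℕ) (e : Expr) (he : e.Fits W s) :
      Run W (.set x e) s (s.setReg x (e.eval s)) (e.cost + 1)
  | store (s : State) (a : ℕ) (i e : Expr) (hi : i.Fits W s) (he : e.Fits W s) :
      Run W (.store a i e) s (s.setMem a (i.eval s) (e.eval s)) (i.cost + e.cost + 1)
  | seq {c d : Cmd} {s s' s'' : State} {t t' : ℕ} (h : Run W c s s' t) (h' : Run W d s' s'' t') :
      Run W (.seq c d) s s'' (t + t')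
  | cond_true {e : Expr} {c d : Cmd} {s s' : State} {t : ℕ} (he : e.Fits W s)
      (hv : e.eval s ≠ 0) (h : Run W c s s' t) : Run W (.cond e c d) s s' (e.cost + 1 + t)
  | cond_false {e : Expr} {c d : Cmd} {s s' : State} {t : ℕ} (he : e.Fits W s)
      (hv : e.eval s = 0) (h : Run W d s s' t) : Run W (.cond e c d) s s' (e.cost + 1 + t)
  | loop_done {e : Expr} {c : Cmd} {s : State} (he : e.Fits W s) (hv : e.eval s = 0) :
      Run W (.loop e c) s s (e.cost + 1)
  | loop_step {e : Expr} {c : Cmd} {s s' s'' : State} {t t' : ℕ} (he : e.Fits W s)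
      (hv : e.eval s ≠ 0) (h : Run W c s s' t) (h' : Run W (.loop e c) s' s'' t') :
      Run W (.loop e c) s s'' (e.cost + 1 + t + t')

/-! ### Dynamic graphs on the fixed vertex set `{0, …, n - 1}` -/

/-- An edge update. -/
inductive Update (n : ℕ) where
  | insert (u v : Fin n)
  | delete (u v : Fin n)

/-- Only absent edges are inserted and only present edges are deleted. -/
def Update.Valid {n : ℕ} (G : SimpleGraph (Fin n)) : Update n → Prop
  | .insert u v => u ≠ v ∧ ¬ G.Adj u v
  | .delete u v => G.Adj u v

/-- The graph after an update. -/
def Update.apply {n : ℕ} (G : SimpleGraph (Fin n)) : Update n → SimpleGraph (Fin n)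
  | .insert u v => G ⊔ SimpleGraph.edge u v
  | .delete u v => G.deleteEdges {s(u, v)}

/-- The graph after the first `i` updates, starting from the empty graph. -/
def graphAt {n : ℕ} (us : List (Update n)) (i : ℕ) : SimpleGraph (Fin n) :=
  (us.take i).foldl Update.apply ⊥

/-- Every update of the sequence is valid at the time when it is made. -/
def ValidSeq {n : ℕ} (us : List (Update n)) : Prop :=
  ∀ (i : ℕ) (h : i < us.length), us[i].Valid (graphAt us i)

/-! ### Dynamic algorithms -/

/-- A dynamic graph algorithm: code for the initialization and for the two kinds of updates. The
code does not depend on the number of vertices. -/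
structure Algorithm where
  init : Cmd
  insert : Cmd
  delete : Cmd

/-- The code that handles a given update. -/
def Algorithm.code (A : Algorithm) {n : ℕ} : Update n → Cmd
  | .insert _ _ => A.insert
  | .delete _ _ => A.delete

/-- At the start, register `0` holds the number of vertices and everything else is `0`. -/
def State.start (n : ℕ) : State where
  reg := fun x => if x = 0 then n else 0
  mem := fun _ _ => 0

/-- An update is announced by writing its two endpoints into the registers `0` and `1`; otherwise
the algorithm finds the state as it left it. -/
def State.announce {n : ℕ} (s : State) : Update n → State
  | .insert u v => (s.setReg 0 u).setReg 1 v
  | .delete u v => (s.setReg 0 u).setReg 1 v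

/-- The vertex set that the algorithm currently outputs: array `0` holds its indicator. -/
def State.output (s : State) (n : ℕ) : Set (Fin n) :=
  {v | s.mem 0 v = 1}

/-- The update time `m ^ (2/3) * √(log m)`, where `m` counts as `2` if it is less than `2`. -/
noncomputable def rate (m : ℕ) : ℝ :=
  ((max m 2 : ℕ) : ℝ) ^ (2 / 3 : ℝ) * Real.sqrt (Real.log ((max m 2 : ℕ) : ℝ))

end DynMIS

namespace DynMIS
open Finset

/-! Light vertices are handled eagerly and heavy ones lazily. A vertex is heavy if, when examined,
its degree `d` satisfies `d ^ 3 > m ^ 2`. The program maintains a set of selected vertices (state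
`1`), independent in the graph, together with the exact number of selected neighbours of each
vertex. A vertex enters this set only while light. A heavy vertex that would otherwise be selected
is only marked (state `2`), and the output adds a greedy choice of marked vertices to the selected
ones, without touching the counters.

An update unmarks everything, deselects both endpoints, changes the edge and re-examines a work
list: the formerly marked vertices, the two endpoints, and the neighbours of those endpoints that
were selected. No other vertex can have become free (`Inv.reset`, `Inv.evict`, `Inv.push`). The
greedy phase tests all pairs of marked vertices. Since degrees sum to `2m`, only `O(m ^ (1/3))`
vertices are marked (`Inv.h_le_cbrt`), so it takes time `O(m ^ (2/3))` (`greedy_spec`).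

Only scans of rows need amortization. With `τ = thr m`, a bound of order `m ^ (2/3)` for the degree
of a vertex being selected, the potential is `200 d` at an unselected vertex and `400 (d - τ)`,
truncated at zero, at a selected one. Selecting releases `200 d`, which pays for counting the vertex
at its neighbours (`examine_spec`). Deselecting releases at least `200 d - 400 τ`, which pays for
the scan and the new list entries up to `O(τ)` (`evict_spec`). Changing the edge, and with it `τ`,
raises the potential by `O(τ)` (`pot_modify`). Hence an update has amortized cost `O(thr m')`, where
`m'` is the new number of edges (`update_spec`). The potential is zero initially, so summation gives
total time `O(∑ thr m)`; this is `O(m ^ (2/3))` per update, and the factor `√(log m)` in `rate` is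
slack (`thr_le_rate`). -/

/-! ### Adjacency rows with position tables -/

theorem idx_inj {n a b x y : ℕ} (hb : b < n) (hy : y < n) (h : a * n + b = x * n + y) :
    a = x ∧ b = y := by
  have h1 : (a * n + b) % n = (x * n + y) % n := by rw [h]
  rw [Nat.mul_add_mod', Nat.mul_add_mod', Nat.mod_eq_of_lt hb, Nat.mod_eq_of_lt hy] at h1
  subst h1
  exact ⟨Nat.eq_of_mul_eq_mul_right (by omega) (Nat.add_right_cancel h), rfl⟩

/-- Adjacency rows of width `n`: row `u` of `A` lists the `D u` neighbours of `u`, and entry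
`(u, v)` of `P` is one more than the position of `v` in that row, or `0` if `v` is absent. -/
structure Rows (n : ℕ) (D A P : ℕ → ℕ) : Prop where
  entry : ∀ u < n, ∀ j < D u, A (u * n + j) < n ∧ P (u * n + A (u * n + j)) = j + 1
  pos : ∀ u < n, ∀ v < n, P (u * n + v) ≠ 0 →
    P (u * n + v) ≤ D u ∧ A (u * n + (P (u * n + v) - 1)) = v

namespace Rows

variable {n : ℕ} {D A P : ℕ → ℕ}

theorem inj (R : Rows n D A P) {u i j : ℕ} (hu : u < n) (hi : i < D u) (hj : j < D u)
    (h : A (u * n + i) = A (u * n + j)) : i = j := by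
  have h1 := (R.entry u hu i hi).2
  have h2 := (R.entry u hu j hj).2
  rw [h] at h1
  omega

/-- `entry` and `pos` make row positions and nonzero position entries correspond bijectively. This
ties the stored `D` to true degrees, hence to the handshake identity and the bound `n`. -/
theorem deg_eq (R : Rows n D A P) {u : ℕ} (hu : u < n) :
    D u = #{v ∈ range n | P (u * n + v) ≠ 0} := by
  conv_lhs => rw [← card_range (D u)]
  refine card_bij (fun j _ => A (u * n + j)) ?_ ?_ ?_
  · intro j hj
    have := R.entry u hu j (mem_range.1 hj)
    simp [this]
  · intro i hi j hj h
    exact R.inj hu (mem_range.1 hi) (mem_range.1 hj) h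
  · intro v hv
    simp only [mem_filter, mem_range] at hv
    have := R.pos u hu v hv.1 hv.2
    exact ⟨P (u * n + v) - 1, mem_range.2 (by omega), this.2⟩

theorem deg_le (R : Rows n D A P) {u : ℕ} (hu : u < n) : D u ≤ n := by
  rw [R.deg_eq hu]
  exact (card_filter_le _ _).trans (by simp)

/-- A non-neighbour leaves a free slot, so appending to row `u` cannot run into row `u + 1`. -/
theorem deg_lt (R : Rows n D A P) {u v : ℕ} (hu : u < n) (hv : v < n) (h : P (u * n + v) = 0) :
    D u < n := by
  rw [R.deg_eq hu]
  refine (card_lt_card (t := range n) ?_).trans_le (by simp)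
  refine ⟨filter_subset _ _, fun hs => ?_⟩
  have := hs (mem_range.2 hv)
  simp [h] at this

theorem link (R : Rows n D A P) {u v : ℕ} (hu : u < n) (hv : v < n) (h : P (u * n + v) = 0) :
    Rows n (Function.update D u (D u + 1)) (Function.update A (u * n + D u) v)
      (Function.update P (u * n + v) (D u + 1)) := by
  have hd := R.deg_lt hu hv h
  have key : ∀ x < n, ∀ j < D x, Function.update A (u * n + D u) v (x * n + j) = A (x * n + j) := by
    intro x hx j hj
    rw [Function.update_of_ne]
    intro e
    have hj' : j < n := hj.trans_le (R.deg_le hx)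
    obtain ⟨rfl, rfl⟩ := idx_inj hj' hd e
    exact lt_irrefl _ hj
  constructor
  · intro x hx j hj
    by_cases hxj : x = u ∧ j = D u
    · obtain ⟨rfl, rfl⟩ := hxj
      simp [hv]
    · have hj' : j < D x := by
        by_cases hxu : x = u
        · subst hxu
          simp at hj
          have : j ≠ D x := fun e => hxj ⟨rfl, e⟩
          omega
        · simpa [hxu] using hj
      have := R.entry x hx j hj'
      rw [key x hx j hj']
      refine ⟨this.1, ?_⟩
      rw [Function.update_of_ne, this.2]
      intro e
      obtain ⟨rfl, e⟩ := idx_inj this.1 hv e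
      rw [e] at this
      omega
  · intro x hx y hy hP
    by_cases hxy : x = u ∧ y = v
    · obtain ⟨rfl, rfl⟩ := hxy
      simp
    · have hne : x * n + y ≠ u * n + v := fun e => hxy (idx_inj hy hv e)
      rw [Function.update_of_ne hne] at hP ⊢
      have := R.pos x hx y hy hP
      refine ⟨this.1.trans ?_, ?_⟩
      · by_cases hxu : x = u
        · subst hxu; simp
        · simp [hxu]
      · rw [key x hx _ (by omega), this.2]

/-- Constant-time deletion: the last entry `w` of the row moves into the hole left by `v`. The
position of `v` is cleared after that of `w` is written, so the case `w = v` needs no special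
treatment. -/
theorem unlink (R : Rows n D A P) {u v : ℕ} (hu : u < n) (hv : v < n) (h : P (u * n + v) ≠ 0) :
    Rows n (Function.update D u (D u - 1))
      (Function.update A (u * n + (P (u * n + v) - 1)) (A (u * n + (D u - 1))))
      (Function.update (Function.update P (u * n + A (u * n + (D u - 1))) (P (u * n + v)))
        (u * n + v) 0) := by
  have hd := R.deg_le hu
  obtain ⟨hp, hA⟩ := R.pos u hu v hv h
  set p := P (u * n + v) with hpdef
  obtain ⟨hw, hPw⟩ := R.entry u hu (D u - 1) (by omega)
  set w := A (u * n + (D u - 1)) with hwdef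
  constructor
  · intro x hx j hj
    have hjx : j < D x := by
      by_cases hxu : x = u
      · subst hxu; simp at hj; omega
      · simpa [hxu] using hj
    have hjn : j < n := hjx.trans_le (R.deg_le hx)
    obtain ⟨h1, h2⟩ := R.entry x hx j hjx
    by_cases hxu : x = u
    · subst hxu
      simp only [Function.update_self] at hj
      by_cases hjp : j = p - 1
      · subst hjp
        rw [Function.update_self]
        refine ⟨hw, ?_⟩
        -- If `w = v`, the hole is the last slot, which lies outside the shortened row.
        have hwv : x * n + w ≠ x * n + v := by
          intro e
          have : w = v := by omega
          rw [this, ← hpdef] at hPw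
          omega
        rw [Function.update_of_ne hwv, Function.update_self]
        omega
      · rw [Function.update_of_ne (by omega)]
        refine ⟨h1, ?_⟩
        have e1 : x * n + A (x * n + j) ≠ x * n + v := by
          intro e
          rw [e, ← hpdef] at h2
          omega
        have e2 : x * n + A (x * n + j) ≠ x * n + w := by
          intro e
          rw [e, hPw] at h2
          omega
        rw [Function.update_of_ne e1, Function.update_of_ne e2, h2]
    · have e0 : x * n + j ≠ u * n + (p - 1) := fun e => hxu (idx_inj hjn (by omega) e).1
      rw [Function.update_of_ne e0]
      refine ⟨h1, ?_⟩
      have e1 : x * n + A (x * n + j) ≠ u * n + v := fun e => hxu (idx_inj h1 hv e).1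
      have e2 : x * n + A (x * n + j) ≠ u * n + w := fun e => hxu (idx_inj h1 hw e).1
      rw [Function.update_of_ne e1, Function.update_of_ne e2, h2]
  · intro x hx y hy hP
    have hne : x * n + y ≠ u * n + v := by
      intro e
      rw [e, Function.update_self] at hP
      exact hP rfl
    rw [Function.update_of_ne hne] at hP ⊢
    by_cases hxw : x * n + y = u * n + w
    · obtain ⟨rfl, rfl⟩ := idx_inj hy hw hxw
      have hpd : p ≠ D x := by
        intro e
        apply hne
        rw [show w = v by rw [hwdef, ← e, hA]]
      simp only [Function.update_self]
      exact ⟨by omega, trivial⟩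
    · rw [Function.update_of_ne hxw] at hP ⊢
      obtain ⟨h1, h2⟩ := R.pos x hx y hy hP
      by_cases hxu : x = u
      · subst hxu
        have e1 : P (x * n + y) ≠ p := by
          intro e
          rw [e] at h2
          exact hne (by omega)
        have e2 : P (x * n + y) ≠ D x := by
          intro e
          rw [e] at h2
          exact hxw (by omega)
        rw [Function.update_self, Function.update_of_ne (by omega)]
        exact ⟨by omega, h2⟩
      · rw [Function.update_of_ne hxu, Function.update_of_ne]
        · exact ⟨h1, h2⟩
        · exact fun e => hxu (idx_inj (by have := R.deg_le hx; omega) (by omega) e).1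

end Rows

/-! ### Selected sets and their neighbour counters -/

/-- The number of neighbours `y` of `x` with `st y = 1`. -/
def dom (n : ℕ) (P st : ℕ → ℕ) (x : ℕ) : ℕ :=
  ∑ y ∈ range n, if st y = 1 ∧ P (x * n + y) ≠ 0 then 1 else 0

theorem dom_le (n : ℕ) (P st : ℕ → ℕ) (x : ℕ) : dom n P st x ≤ n := by
  unfold dom
  refine (sum_le_card_nsmul _ _ 1 fun y _ => ?_).trans (by simp)
  split_ifs <;> omega

theorem dom_eq_zero {n : ℕ} {P st : ℕ → ℕ} {x : ℕ} (h : dom n P st x = 0) {y : ℕ} (hy : y < n)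
    (hs : st y = 1) : P (x * n + y) = 0 := by
  unfold dom at h
  have := (sum_eq_zero_iff.1 h) y (mem_range.2 hy)
  by_contra hP
  simp [hs, hP] at this

theorem exists_of_dom {n : ℕ} {P st : ℕ → ℕ} {x : ℕ} (h : dom n P st x ≠ 0) :
    ∃ y < n, st y = 1 ∧ P (x * n + y) ≠ 0 := by
  obtain ⟨y, hy, h⟩ := exists_ne_zero_of_sum_ne_zero h
  exact ⟨y, mem_range.1 hy, by by_contra hc; exact h (if_neg hc)⟩

/-- The effect of changing one summand, put additively to avoid truncated subtraction. It serves the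
counters, the potential and the degree sum alike. -/
theorem sum_update_le {n u : ℕ} (hu : u < n) (f : ℕ → ℕ → ℕ) (st : ℕ → ℕ) (b : ℕ) :
    ∑ x ∈ range n, f x (Function.update st u b x) + f u (st u) =
      ∑ x ∈ range n, f x (st x) + f u b := by
  rw [← add_sum_erase _ _ (mem_range.2 hu),
    ← add_sum_erase (range n) (fun x => f x (st x)) (mem_range.2 hu)]
  have : ∑ x ∈ (range n).erase u, f x (Function.update st u b x) =
      ∑ x ∈ (range n).erase u, f x (st x) :=
    sum_congr rfl fun x hx => by rw [Function.update_of_ne (ne_of_mem_erase hx)]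
  rw [this]
  simp
  ring

theorem dom_update {n u : ℕ} (hu : u < n) (P st : ℕ → ℕ) (b x : ℕ) :
    dom n P (Function.update st u b) x + (if st u = 1 ∧ P (x * n + u) ≠ 0 then 1 else 0) =
      dom n P st x + (if b = 1 ∧ P (x * n + u) ≠ 0 then 1 else 0) :=
  sum_update_le hu (fun y s => if s = 1 ∧ P (x * n + y) ≠ 0 then 1 else 0) st b

/-- The arrays represent a graph with `m` edges and an independent set `{x | st x = 1}`. -/
structure Base (n m : ℕ) (D A P c st : ℕ → ℕ) : Prop where
  rows : Rows n D A P
  symm : ∀ u < n, ∀ v < n, P (u * n + v) ≠ 0 → P (v * n + u) ≠ 0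
  irrefl : ∀ u < n, P (u * n + u) = 0
  sum : ∑ u ∈ range n, D u = 2 * m
  cnt : ∀ x < n, c x = dom n P st x
  indep : ∀ x < n, ∀ y < n, st x = 1 → st y = 1 → P (x * n + y) = 0

/-- Truncation in the decrement is harmless: a neighbour of the selected `u` counts `u`, so its
counter is positive. -/
theorem Base.evict {n m : ℕ} {D A P c st : ℕ → ℕ} (B : Base n m D A P c st) {u : ℕ} (hu : u < n)
    (hs : st u = 1) {c' : ℕ → ℕ} (hc : ∀ w < n, c' w = c w - if P (u * n + w) ≠ 0 then 1 else 0) :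
    Base n m D A P c' (Function.update st u 0) := by
  refine { B with cnt := fun x hx => ?_, indep := fun x hx y hy h1 h2 => ?_ }
  · have h := dom_update hu P st 0 x
    have hsym : P (u * n + x) ≠ 0 ↔ P (x * n + u) ≠ 0 := ⟨B.symm _ hu _ hx, B.symm _ hx _ hu⟩
    rw [hc x hx, B.cnt x hx]
    simp only [hsym]
    simp [hs] at h
    split_ifs at * <;> omega
  · have a : ∀ z, Function.update st u 0 z = 1 → st z = 1 := by
      intro z hz
      by_cases e : z = u
      · rw [e]; exact hs
      · rwa [Function.update_of_ne e] at hz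
    exact B.indep x hx y hy (a x h1) (a y h2)

theorem Base.select {n m : ℕ} {D A P c st : ℕ → ℕ} (B : Base n m D A P c st) {u : ℕ}
    (hu : u < n) (hs : st u ≠ 1) (h0 : c u = 0) {c' : ℕ → ℕ}
    (hc : ∀ w < n, c' w = c w + if P (u * n + w) ≠ 0 then 1 else 0) :
    Base n m D A P c' (Function.update st u 1) := by
  have hz : ∀ y < n, st y = 1 → P (u * n + y) = 0 := fun y hy =>
    dom_eq_zero (by rw [← B.cnt u hu, h0]) hy
  refine { B with cnt := fun x hx => ?_, indep := fun x hx y hy h1 h2 => ?_ }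
  · have h := dom_update hu P st 1 x
    have hsym : P (u * n + x) ≠ 0 ↔ P (x * n + u) ≠ 0 := ⟨B.symm _ hu _ hx, B.symm _ hx _ hu⟩
    rw [hc x hx, B.cnt x hx]
    simp only [hsym]
    simp [hs] at h
    split_ifs at * <;> omega
  · by_cases ex : x = u <;> by_cases ey : y = u
    · subst ex; subst ey; exact B.irrefl _ hx
    · subst ex
      rw [Function.update_of_ne ey] at h2
      exact hz y hy h2
    · subst ey
      rw [Function.update_of_ne ex] at h1
      by_contra hP
      exact B.symm _ hx _ hy hP (hz x hx h1)
    · rw [Function.update_of_ne ex] at h1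
      rw [Function.update_of_ne ey] at h2
      exact B.indep x hx y hy h1 h2

/-- Changing edges whose endpoints are not selected keeps the counters correct. -/
theorem Base.modify {n m m' : ℕ} {D A P c st D' A' P' : ℕ → ℕ} (B : Base n m D A P c st)
    {u v : ℕ} (hsu : st u ≠ 1) (hsv : st v ≠ 1) (R : Rows n D' A' P')
    (hsymm : ∀ u < n, ∀ v < n, P' (u * n + v) ≠ 0 → P' (v * n + u) ≠ 0)
    (hirr : ∀ u < n, P' (u * n + u) = 0)
    (hP : ∀ x < n, ∀ y < n, ¬ (x = u ∧ y = v) → ¬ (x = v ∧ y = u) →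
      (P' (x * n + y) ≠ 0 ↔ P (x * n + y) ≠ 0))
    (hsum : ∑ u ∈ range n, D' u = 2 * m') : Base n m' D' A' P' c st := by
  have key : ∀ x < n, ∀ y < n, st y = 1 → (P' (x * n + y) ≠ 0 ↔ P (x * n + y) ≠ 0) := by
    intro x hx y hy hs
    apply hP x hx y hy
    · rintro ⟨-, rfl⟩; exact hsv hs
    · rintro ⟨-, rfl⟩; exact hsu hs
  refine ⟨R, hsymm, hirr, hsum, fun x hx => ?_, fun x hx y hy h1 h2 => ?_⟩
  · rw [B.cnt x hx]
    unfold dom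
    refine sum_congr rfl fun y hy => ?_
    have := key x hx y (mem_range.1 hy)
    by_cases hs : st y = 1
    · simp [hs, this hs]
    · simp [hs]
  · have := key x hx y hy h2
    have h := B.indep x hx y hy h1 h2
    tauto

/-! ### The work-list invariant -/

/-- The state of the work list `l`: its first `h` entries are the marked vertices (`st = 2`), and
entries `i, …, q - 1` are still to be examined. -/
structure Inv (n m i q h : ℕ) (D A P c l st : ℕ → ℕ) : Prop where
  base : Base n m D A P c st
  le_two : ∀ x < n, st x ≤ 2
  h_le : h ≤ i
  marked : ∀ j < h, l j < n ∧ st (l j) = 2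
  inj : ∀ j < h, ∀ j' < h, l j = l j' → j = j'
  mem_marked : ∀ x < n, st x = 2 → ∃ j < h, l j = x
  heavy : ∀ x < n, st x = 2 → m * m < D x * D x * D x
  pending : ∀ x < n, st x = 0 → c x = 0 → ∃ j, i ≤ j ∧ j < q ∧ l j = x
  pending_lt : ∀ j, i ≤ j → j < q → l j < n

namespace Inv

variable {n m i q h : ℕ} {D A P c l st : ℕ → ℕ}

theorem h_le_n (I : Inv n m i q h D A P c l st) : h ≤ n := by
  have : (range h).card ≤ (range n).card := by
    refine card_le_card_of_injOn l (fun j hj => ?_) fun j hj j' hj' e => ?_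
    · simp at hj ⊢; exact (I.marked j hj).1
    · simp at hj hj'; exact I.inj j hj j' hj' e
  simpa using this

theorem st_le_one (I : Inv n m i q 0 D A P c l st) {x : ℕ} (hx : x < n) : st x ≤ 1 := by
  have h1 := I.le_two x hx
  have h2 : st x ≠ 2 := fun e => by
    obtain ⟨j, hj, -⟩ := I.mem_marked x hx e
    omega
  omega

/-- Marked vertices enter neither counters nor independence, so unmarking preserves both. Once the
list is exhausted, every unselected unmarked vertex has a selected neighbour; the only candidates
after unmarking are the first `h` entries, which thus already form the new work list. -/
theorem reset (I : Inv n m q q h D A P c l st) {st' : ℕ → ℕ}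
    (hs : ∀ x < n, st' x = if st x = 2 then 0 else st x) : Inv n m 0 h 0 D A P c l st' := by
  have h1 : ∀ x < n, (st' x = 1 ↔ st x = 1) := by
    intro x hx
    rw [hs x hx]
    by_cases e : st x = 2 <;> simp [e]
  have h2 : ∀ x < n, st' x ≤ 1 := by
    intro x hx
    have := I.le_two x hx
    rw [hs x hx]
    split_ifs <;> omega
  refine ⟨{ I.base with cnt := fun x hx => ?_, indep := fun x hx y hy a b => ?_ },
    fun x hx => (h2 x hx).trans (by omega), le_rfl, by simp, by simp, fun x hx e => ?_,
    fun x hx e => ?_, fun x hx e0 ec => ?_, fun j _ hj => (I.marked j hj).1⟩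
  · rw [I.base.cnt x hx]
    unfold dom
    exact sum_congr rfl fun y hy => by simp only [h1 y (mem_range.1 hy)]
  · exact I.base.indep x hx y hy ((h1 x hx).1 a) ((h1 y hy).1 b)
  · have := h2 x hx; omega
  · have := h2 x hx; omega
  · rw [hs x hx] at e0
    have h2 : st x = 2 := by
      by_contra hne
      rw [if_neg hne] at e0
      obtain ⟨j, a, b, -⟩ := I.pending x hx e0 ec
      omega
    obtain ⟨j, hj, e⟩ := I.mem_marked x hx h2
    exact ⟨j, by omega, hj, e⟩

theorem push (I : Inv n m 0 q 0 D A P c l st) {u : ℕ} (hu : u < n) {l' : ℕ → ℕ}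
    (hl : ∀ j < q, l' j = l j) (hq : l' q = u) : Inv n m 0 (q + 1) 0 D A P c l' st := by
  refine { I with
    marked := by simp, inj := by simp, mem_marked := fun x hx e => ?_,
    pending := fun x hx a b => ?_, pending_lt := fun j _ hj => ?_ }
  · have := I.st_le_one hx; omega
  · obtain ⟨j, -, h1, h2⟩ := I.pending x hx a b
    exact ⟨j, by omega, by omega, by rw [hl j h1, h2]⟩
  · rcases Nat.lt_succ_iff_lt_or_eq.1 hj with h | rfl
    · rw [hl j h]; exact I.pending_lt j (by omega) h
    · rwa [hq]

/-- Only `u` and vertices whose counter drops, that is, neighbours of `u`, can become free, and all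
of these are appended. -/
theorem evict (I : Inv n m 0 q 0 D A P c l st) {u : ℕ} (hu : u < n) (hs : st u = 1)
    {c' l' : ℕ → ℕ} (hc : ∀ w < n, c' w = c w - if P (u * n + w) ≠ 0 then 1 else 0)
    (hl : ∀ j < q, l' j = l j) (hl' : ∀ j < D u, l' (q + j) = A (u * n + j))
    (hq : l' (q + D u) = u) :
    Inv n m 0 (q + D u + 1) 0 D A P c' l' (Function.update st u 0) := by
  have h1 : ∀ x < n, Function.update st u 0 x ≤ 1 := by
    intro x hx
    have := I.st_le_one hx
    by_cases e : x = u
    · subst e; simp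
    · rwa [Function.update_of_ne e]
  refine ⟨I.base.evict hu hs hc, fun x hx => (h1 x hx).trans (by omega), le_rfl, by simp, by simp,
    fun x hx e => ?_, fun x hx e => ?_, fun x hx a b => ?_, fun j _ hj => ?_⟩
  · have := h1 x hx; omega
  · have := h1 x hx; omega
  · by_cases e : x = u
    · subst e
      exact ⟨q + D x, by omega, by omega, hq⟩
    rw [Function.update_of_ne e] at a
    by_cases hP : P (u * n + x) = 0
    · rw [hc x hx] at b
      simp [hP] at b
      obtain ⟨j, -, g1, g2⟩ := I.pending x hx a b
      exact ⟨j, by omega, by omega, by rw [hl j g1, g2]⟩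
    · obtain ⟨g1, g2⟩ := I.base.rows.pos u hu x hx hP
      exact ⟨q + (P (u * n + x) - 1), by omega, by omega, by rw [hl' _ (by omega), g2]⟩
  · by_cases g : j < q
    · rw [hl j g]; exact I.pending_lt j (by omega) g
    · obtain ⟨k, rfl⟩ := Nat.exists_eq_add_of_le (not_lt.1 g)
      rcases Nat.lt_succ_iff_lt_or_eq.1 (show k < D u + 1 by omega) with g | rfl
      · rw [hl' k g]; exact (I.base.rows.entry u hu k g).1
      · rwa [hq]

theorem modify {m' : ℕ} {D' A' P' : ℕ → ℕ} (I : Inv n m 0 q 0 D A P c l st)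
    (B : Base n m' D' A' P' c st) : Inv n m' 0 q 0 D' A' P' c l st :=
  { I with
    base := B
    heavy := fun x hx e => by have := I.st_le_one hx; omega }

theorem advance_skip (I : Inv n m i q h D A P c l st)
    (hs : st (l i) ≠ 0 ∨ c (l i) ≠ 0) : Inv n m (i + 1) q h D A P c l st := by
  refine { I with
    h_le := by have := I.h_le; omega
    pending := fun x hx a b => ?_
    pending_lt := fun j h1 h2 => I.pending_lt j (by omega) h2 }
  obtain ⟨j, h1, h2, rfl⟩ := I.pending x hx a b
  rcases Nat.lt_or_ge i j with h | h
  · exact ⟨j, h, h2, rfl⟩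
  · have : i = j := by omega
    subst this
    omega

/-- The list of marked vertices overwrites the work list in place. Since `h ≤ i`, the write hits an
entry that has already been read. -/
theorem advance_mark (I : Inv n m i q h D A P c l st) (hi : i < q) (hs : st (l i) = 0)
    (hm : m * m < D (l i) * D (l i) * D (l i)) :
    Inv n m (i + 1) q (h + 1) D A P c (Function.update l h (l i))
      (Function.update st (l i) 2) := by
  have hx := I.pending_lt i le_rfl hi
  have hle := I.h_le
  set x := l i with hxdef
  have h1 : ∀ y, Function.update st x 2 y = 1 ↔ st y = 1 := by
    intro y
    by_cases e : y = x
    · subst e; simp; omega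
    · rw [Function.update_of_ne e]
  refine ⟨{ I.base with cnt := fun y hy => ?_, indep := fun y hy z hz a b => ?_ },
    fun y hy => ?_, by omega, fun j hj => ?_, fun j hj j' hj' e => ?_, fun y hy e => ?_,
    fun y hy e => ?_, fun y hy a b => ?_, fun j a b => ?_⟩
  · rw [I.base.cnt y hy]
    unfold dom
    simp only [h1]
  · exact I.base.indep y hy z hz ((h1 y).1 a) ((h1 z).1 b)
  · by_cases e : y = x
    · subst e; simp
    · rw [Function.update_of_ne e]; exact I.le_two y hy
  · by_cases e : j = h
    · subst e; simpa using hx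
    · rw [Function.update_of_ne e]
      obtain ⟨g1, g2⟩ := I.marked j (by omega)
      refine ⟨g1, ?_⟩
      by_cases e : l j = x
      · rw [e]; simp
      · rwa [Function.update_of_ne e]
  · have key : ∀ k < h, l k ≠ x := by
      intro k hk e
      have := (I.marked k hk).2
      rw [e] at this
      omega
    by_cases e1 : j = h <;> by_cases e2 : j' = h
    · omega
    · subst e1
      rw [Function.update_self, Function.update_of_ne e2] at e
      exact absurd e.symm (key j' (by omega))
    · subst e2
      rw [Function.update_self, Function.update_of_ne e1] at e
      exact absurd e (key j (by omega))
    · rw [Function.update_of_ne e1, Function.update_of_ne e2] at e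
      exact I.inj j (by omega) j' (by omega) e
  · by_cases g : y = x
    · exact ⟨h, by omega, by rw [g]; simp⟩
    · rw [Function.update_of_ne g] at e
      obtain ⟨j, hj, e⟩ := I.mem_marked y hy e
      exact ⟨j, by omega, by rw [Function.update_of_ne (by omega), e]⟩
  · by_cases g : y = x
    · rwa [g]
    · rw [Function.update_of_ne g] at e
      exact I.heavy y hy e
  · have g : y ≠ x := by
      rintro rfl
      simp at a
    rw [Function.update_of_ne g] at a
    obtain ⟨j, g1, g2, e⟩ := I.pending y hy a b
    have : j ≠ i := by
      rintro rfl
      exact g e.symm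
    exact ⟨j, by omega, g2, by rw [Function.update_of_ne (by omega), e]⟩
  · rw [Function.update_of_ne (by omega)]
    exact I.pending_lt j (by omega) b

/-- Selecting a vertex only raises counters, so no new vertex becomes pending. -/
theorem advance_add (I : Inv n m i q h D A P c l st) (hi : i < q) (hs : st (l i) = 0)
    (h0 : c (l i) = 0) {c' : ℕ → ℕ}
    (hc : ∀ w < n, c' w = c w + if P (l i * n + w) ≠ 0 then 1 else 0) :
    Inv n m (i + 1) q h D A P c' l (Function.update st (l i) 1) := by
  have hx := I.pending_lt i le_rfl hi
  have hle := I.h_le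
  set x := l i with hxdef
  have h2 : ∀ y, Function.update st x 1 y = 2 ↔ st y = 2 := by
    intro y
    by_cases e : y = x
    · subst e; simp; omega
    · rw [Function.update_of_ne e]
  refine ⟨I.base.select hx (by omega) h0 hc, fun y hy => ?_, by omega, fun j hj => ?_,
    I.inj, fun y hy e => ?_, fun y hy e => ?_, fun y hy a b => ?_,
    fun j a b => I.pending_lt j (by omega) b⟩
  · by_cases e : y = x
    · subst e; simp
    · rw [Function.update_of_ne e]; exact I.le_two y hy
  · rw [h2]; exact I.marked j hj
  · exact I.mem_marked y hy ((h2 y).1 e)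
  · exact I.heavy y hy ((h2 y).1 e)
  · have g : y ≠ x := by
      rintro rfl
      simp at a
    rw [Function.update_of_ne g] at a
    have b' : c y = 0 := by
      rw [hc y hy] at b
      omega
    obtain ⟨j, g1, g2, e⟩ := I.pending y hy a b'
    have : j ≠ i := by
      rintro rfl
      exact g e.symm
    exact ⟨j, by omega, g2, e⟩

end Inv

/-! ### Weakest-precondition rules -/

/-- The code `c` started in `s` halts, and `Q` holds of the final state and the running time. -/
def Does (W : ℕ) (c : Cmd) (s : State) (Q : State → ℕ → Prop) : Prop :=
  ∃ s' t, Run W c s s' t ∧ Q s' t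

section Does

variable {W : ℕ} {s : State} {Q : State → ℕ → Prop}

theorem Does.mono {c : Cmd} {Q' : State → ℕ → Prop} (h : Does W c s Q)
    (hQ : ∀ s' t, Q s' t → Q' s' t) : Does W c s Q' := by
  obtain ⟨s', t, h1, h2⟩ := h
  exact ⟨s', t, h1, hQ _ _ h2⟩

/-- This and the next rules are equivalences, so that `simp` can execute loop-free code
symbolically. -/
theorem does_skip : Does W .skip s Q ↔ Q s 1 := by
  constructor
  · rintro ⟨s', t, h, hQ⟩
    cases h
    exact hQ
  · exact fun h => ⟨_, _, .skip s, h⟩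

theorem does_set {x : ℕ} {e : Expr} :
    Does W (.set x e) s Q ↔ e.Fits W s ∧ Q (s.setReg x (e.eval s)) (e.cost + 1) := by
  constructor
  · rintro ⟨s', t, h, hQ⟩
    cases h with
    | set _ _ _ he => exact ⟨he, hQ⟩
  · exact fun h => ⟨_, _, .set s x e h.1, h.2⟩

theorem does_store {a : ℕ} {i e : Expr} :
    Does W (.store a i e) s Q ↔ i.Fits W s ∧ e.Fits W s ∧
      Q (s.setMem a (i.eval s) (e.eval s)) (i.cost + e.cost + 1) := by
  constructor
  · rintro ⟨s', t, h, hQ⟩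
    cases h with
    | store _ _ _ _ hi he => exact ⟨hi, he, hQ⟩
  · exact fun h => ⟨_, _, .store s a i e h.1 h.2.1, h.2.2⟩

theorem does_seq {c d : Cmd} :
    Does W (.seq c d) s Q ↔ Does W c s fun s' t => Does W d s' fun s'' t' => Q s'' (t + t') := by
  constructor
  · rintro ⟨s', t, h, hQ⟩
    cases h with
    | seq h h' => exact ⟨_, _, h, _, _, h', hQ⟩
  · rintro ⟨_, _, h, _, _, h', hQ⟩
    exact ⟨_, _, .seq h h', hQ⟩

theorem does_cond {e : Expr} {c d : Cmd} :
    Does W (.cond e c d) s Q ↔ e.Fits W s ∧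
      (e.eval s ≠ 0 → Does W c s fun s' t => Q s' (e.cost + 1 + t)) ∧
      (e.eval s = 0 → Does W d s fun s' t => Q s' (e.cost + 1 + t)) := by
  constructor
  · rintro ⟨s', t, h, hQ⟩
    cases h with
    | cond_true he hv h => exact ⟨he, fun _ => ⟨_, _, h, hQ⟩, fun h => absurd h hv⟩
    | cond_false he hv h => exact ⟨he, fun h => absurd hv h, fun _ => ⟨_, _, h, hQ⟩⟩
  · rintro ⟨he, h1, h2⟩
    by_cases hv : e.eval s = 0
    · obtain ⟨_, _, h, hQ⟩ := h2 hv
      exact ⟨_, _, .cond_false he hv h, hQ⟩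
    · obtain ⟨_, _, h, hQ⟩ := h1 hv
      exact ⟨_, _, .cond_true he hv h, hQ⟩

/-- A loop of `q` rounds; the invariant `I j s t` holds after `j` rounds and time `t`. -/
theorem does_loop {e : Expr} {c : Cmd} (q : ℕ) (I : ℕ → State → ℕ → Prop) (h0 : I 0 s 0)
    (step : ∀ j < q, ∀ s t, I j s t → e.Fits W s ∧ e.eval s ≠ 0 ∧
      Does W c s fun s' t' => I (j + 1) s' (t + (e.cost + 1 + t')))
    (done : ∀ s t, I q s t → e.Fits W s ∧ e.eval s = 0 ∧ Q s (t + (e.cost + 1))) :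
    Does W (.loop e c) s Q := by
  suffices H : ∀ k j, j + k = q → ∀ s t, I j s t →
      Does W (.loop e c) s fun s' t' => Q s' (t + t') by
    simpa using H q 0 (by omega) s 0 h0
  intro k
  induction k with
  | zero =>
    intro j hj s t hI
    obtain rfl : j = q := by omega
    obtain ⟨h1, h2, h3⟩ := done s t hI
    exact ⟨_, _, .loop_done h1 h2, h3⟩
  | succ k ih =>
    intro j hj s t hI
    obtain ⟨h1, h2, s', t', h3, h4⟩ := step j (by omega) s t hI
    obtain ⟨s'', t'', h5, h6⟩ := ih (j + 1) (by omega) s' _ h4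
    refine ⟨_, _, .loop_step h1 h2 h3 h5, ?_⟩
    convert h6 using 1
    omega

/-- Consecutive commands. -/
def block : List Cmd → Cmd
  | [] => .skip
  | [c] => c
  | c :: d :: l => .seq c (block (d :: l))

theorem block_one (c : Cmd) : block [c] = c := rfl

theorem block_cons (c d : Cmd) (l : List Cmd) :
    block (c :: d :: l) = .seq c (block (d :: l)) := rfl

end Does

theorem setReg_reg (s : State) (x v y : ℕ) :
    (s.setReg x v).reg y = if y = x then v else s.reg y := by
  simp [State.setReg, Function.update_apply]

theorem setReg_mem (s : State) (x v : ℕ) : (s.setReg x v).mem = s.mem := rfl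

theorem setMem_reg (s : State) (a i v : ℕ) : (s.setMem a i v).reg = s.reg := rfl

theorem setMem_mem (s : State) (a i v b : ℕ) :
    (s.setMem a i v).mem b = if b = a then Function.update (s.mem a) i v else s.mem b := by
  simp [State.setMem, Function.update_apply]

/-! ### The program

Arrays: `0` the output, `1` degrees, `2` adjacency rows, `3` positions in the rows, `4` numbers of
selected neighbours, `5` the work list, `6` vertex states.
Registers: `0`, `1` the endpoints, `2` the number of vertices, `3` the number of edges, `4` the
length of the list, and from `5` on auxiliary ones. -/

abbrev kst (c : ℕ) : Expr := .const c
abbrev var (x : ℕ) : Expr := .reg x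
abbrev ld (a : ℕ) (i : Expr) : Expr := .load a i
abbrev plus (e f : Expr) : Expr := .op .add e f
abbrev minus (e f : Expr) : Expr := .op .sub e f
abbrev times (e f : Expr) : Expr := .op .mul e f
abbrev less (e f : Expr) : Expr := .op .lt e f
abbrev same (e f : Expr) : Expr := .op .eq e f
/-- The index of entry `e` in the row of the vertex in register `7`. -/
abbrev row (e : Expr) : Expr := plus (times (var 7) (var 2)) e
abbrev incr (x : ℕ) : Cmd := .set x (plus (var x) (kst 1))
/-- Append the vertex in register `x` to the work list. -/
abbrev append (x : ℕ) : List Cmd := [.store 5 (var 4) (var x), incr 4]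

def initCode : Cmd := block [
  .set 2 (var 0),
  .loop (less (var 5) (var 2)) (block [
    .store 0 (var 5) (kst 1),
    .store 6 (var 5) (kst 1),
    incr 5])]

/-- Unmark the vertices of the work list. -/
def resetCode : Cmd := block [
  .set 5 (kst 0),
  .loop (less (var 5) (var 4)) (block [
    .set 7 (ld 5 (var 5)),
    .store 0 (var 7) (kst 0),
    .store 6 (var 7) (kst 0),
    incr 5])]

/-- Uncount the vertex in register `7` at its neighbours, and append these to the work list. -/
def uncountCode : Cmd := .loop (less (var 6) (ld 1 (var 7))) (block [
  .set 8 (ld 2 (row (var 6))),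
  .store 4 (var 8) (minus (ld 4 (var 8)) (kst 1)),
  .store 5 (var 4) (var 8),
  incr 4,
  incr 6])

/-- Deselect the vertex in register `7`. -/
def evictCode : Cmd := block [
  .cond (same (ld 6 (var 7)) (kst 1))
    (block [
      .set 6 (kst 0),
      uncountCode,
      .store 0 (var 7) (kst 0),
      .store 6 (var 7) (kst 0)])
    .skip,
  .store 5 (var 4) (var 7),
  incr 4]

/-- Append the vertex in register `8` to the row of the vertex in register `7`. -/
def linkCode : Cmd := block [
  .store 2 (row (ld 1 (var 7))) (var 8),
  .store 1 (var 7) (plus (ld 1 (var 7)) (kst 1)),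
  .store 3 (row (var 8)) (ld 1 (var 7))]

/-- Remove the vertex in register `8` from the row of the vertex in register `7`. -/
def unlinkCode : Cmd := block [
  .set 6 (ld 3 (row (var 8))),
  .store 1 (var 7) (minus (ld 1 (var 7)) (kst 1)),
  .set 10 (ld 2 (row (ld 1 (var 7)))),
  .store 2 (row (minus (var 6) (kst 1))) (var 10),
  .store 3 (row (var 10)) (var 6),
  .store 3 (row (var 8)) (kst 0)]

/-- Count the vertex in register `7` at its neighbours. -/
def countCode : Cmd := .loop (less (var 6) (ld 1 (var 7))) (block [
  .set 8 (ld 2 (row (var 6))),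
  .store 4 (var 8) (plus (ld 4 (var 8)) (kst 1)),
  incr 6])

/-- Examine the vertex in register `7`: if it is neither selected nor marked and has no selected
neighbour, mark it if its degree exceeds `m ^ (2/3)`, and select it otherwise. -/
def examineCode : Cmd :=
  .cond (plus (ld 6 (var 7)) (ld 4 (var 7))) .skip
    (.cond (less (times (var 3) (var 3))
        (times (times (ld 1 (var 7)) (ld 1 (var 7))) (ld 1 (var 7))))
      (block [
        .store 5 (var 4) (var 7),
        incr 4,
        .store 6 (var 7) (kst 2)])
      (block [
        .store 0 (var 7) (kst 1),
        .store 6 (var 7) (kst 1),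
        .set 6 (kst 0),
        countCode]))

def processCode : Cmd := block [
  .set 9 (var 4),
  .set 4 (kst 0),
  .set 5 (kst 0),
  .loop (less (var 5) (var 9)) (block [
    .set 7 (ld 5 (var 5)),
    examineCode,
    incr 5])]

/-- Add to register `10` a number that is nonzero iff the vertex in register `7` has a neighbour in
the output among the first entries of the work list. -/
def conflictCode : Cmd := .loop (less (var 6) (var 5)) (block [
  .set 8 (ld 5 (var 6)),
  .set 10 (less (kst 0) (plus (var 10) (times (ld 0 (var 8)) (ld 3 (row (var 8)))))),
  incr 6])

/-- Extend the output greedily by marked vertices. -/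
def greedyCode : Cmd := block [
  .set 5 (kst 0),
  .loop (less (var 5) (var 4)) (block [
    .set 7 (ld 5 (var 5)),
    .set 10 (ld 4 (var 7)),
    .set 6 (kst 0),
    conflictCode,
    .cond (var 10) .skip (.store 0 (var 7) (kst 1)),
    incr 5])]

/-- Change the edge between the vertices in registers `0` and `1`, where `half` changes one row and
`count` updates the number of edges. -/
def edgeCode (half count : Cmd) : Cmd := block [
  .set 7 (var 0),
  .set 8 (var 1),
  half,
  .set 7 (var 1),
  .set 8 (var 0),
  half,
  count]

/-- Handle an update. -/
def updateCode (half count : Cmd) : Cmd := block [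
  resetCode,
  .set 7 (var 0),
  evictCode,
  .set 7 (var 1),
  evictCode,
  edgeCode half count,
  processCode,
  greedyCode]

def misAlgorithm : Algorithm where
  init := initCode
  insert := updateCode linkCode (incr 3)
  delete := updateCode unlinkCode (.set 3 (minus (var 3) (kst 1)))

/-! ### Word size -/

/-- Words below `W` suffice for all numbers that occur on graphs with `n` vertices. -/
structure Big (n W : ℕ) : Prop where
  lin : 5 * n + 10 < W
  idx : ∀ a < n, ∀ j ≤ n, a * n + j < W
  sq : ∀ m ≤ n * n, m * m < W
  cube : ∀ d ≤ n, d * d * d < W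

/-- The number of highest order is the square of an edge count, at most `n ^ 4`. The exponent `6`
leaves room, and the constant term `64` settles small `n`. -/
theorem big_pow (n : ℕ) : Big n ((n + 2) ^ 6) := by
  have e : (n + 2) ^ 6 = n ^ 6 + 12 * n ^ 5 + 60 * n ^ 4 + 160 * n ^ 3 + 240 * n ^ 2 +
    192 * n + 64 := by ring
  rw [e]
  refine ⟨?_, fun a ha j hj => ?_, fun m hm => ?_, fun d hd => ?_⟩
  · have := Nat.zero_le (n ^ 6); omega
  · have : a * n ≤ n * n := Nat.mul_le_mul_right _ ha.le
    nlinarith [Nat.zero_le (n ^ 6), Nat.zero_le (n ^ 5), Nat.zero_le (n ^ 4), Nat.zero_le (n ^ 3)]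
  · have : m * m ≤ (n * n) * (n * n) := Nat.mul_le_mul hm hm
    nlinarith [Nat.zero_le (n ^ 6), Nat.zero_le (n ^ 5), Nat.zero_le (n ^ 4), Nat.zero_le (n ^ 3)]
  · have : d * d * d ≤ n * n * n := Nat.mul_le_mul (Nat.mul_le_mul hd hd) hd
    nlinarith [Nat.zero_le (n ^ 6), Nat.zero_le (n ^ 5), Nat.zero_le (n ^ 4), Nat.zero_le (n ^ 3)]

theorem Big.mul {n W a : ℕ} (B : Big n W) (ha : a < n) : a * n < W := by
  simpa using B.idx a ha 0 (Nat.zero_le _)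

theorem Big.square {n W d : ℕ} (B : Big n W) (hd : d ≤ n) : d * d < W := by
  rcases Nat.eq_zero_or_pos d with rfl | h
  · have := B.lin; omega
  · exact (Nat.le_mul_of_pos_right _ h).trans_lt (B.cube d hd)

theorem Big.edges {n W m : ℕ} (B : Big n W) (hm : m ≤ n * n) : m < W := by
  rcases Nat.eq_zero_or_pos m with rfl | h
  · have := B.lin; omega
  · exact (Nat.le_mul_of_pos_right _ h).trans_lt (B.sq m hm)

attribute [simp] block_one block_cons does_skip does_set does_store does_seq does_cond Expr.Fits
  Expr.eval Op.eval Expr.cost setReg_reg setReg_mem setMem_reg setMem_mem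

/-! ### Specifications of the subroutines -/

/-- `s` and `s'` differ at most on the registers in `R` and the arrays in `M`. -/
def Same (R M : List ℕ) (s s' : State) : Prop :=
  (∀ x, x ∉ R → s'.reg x = s.reg x) ∧ ∀ a, a ∉ M → s'.mem a = s.mem a

theorem Same.refl (R M : List ℕ) (s : State) : Same R M s s := ⟨fun _ _ => rfl, fun _ _ => rfl⟩

theorem Same.mono {R M R' M' : List ℕ} {s s' : State} (h : Same R M s s') (hR : R ⊆ R')
    (hM : M ⊆ M') : Same R' M' s s' :=
  ⟨fun x hx => h.1 x fun hx' => hx (hR hx'), fun a ha => h.2 a fun ha' => ha (hM ha')⟩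

/-- The position table expresses the loop invariant: after `j` rounds the neighbours already treated
are those whose position entry is nonzero and at most `j`. -/
theorem uncount_spec {W n u q : ℕ} {s : State} (B : Big n W)
    (R : Rows n (s.mem 1) (s.mem 2) (s.mem 3)) (hc : ∀ w < n, s.mem 4 w ≤ n)
    (h2 : s.reg 2 = n) (h4 : s.reg 4 = q) (h6 : s.reg 6 = 0) (h7 : s.reg 7 = u) (hu : u < n)
    (hq : q ≤ 3 * n) :
    Does W uncountCode s fun s' t => Same [4, 6, 8] [4, 5] s s' ∧ s'.reg 4 = q + s.mem 1 u ∧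
      (∀ w < n, s'.mem 4 w = s.mem 4 w - if s.mem 3 (u * n + w) ≠ 0 then 1 else 0) ∧
      (∀ k < q, s'.mem 5 k = s.mem 5 k) ∧
      (∀ k < s.mem 1 u, s'.mem 5 (q + k) = s.mem 2 (u * n + k)) ∧ t ≤ 50 * s.mem 1 u + 10 := by
  have hD := R.deg_le hu
  have hW := B.lin
  refine does_loop (s.mem 1 u) (fun j s' t => Same [4, 6, 8] [4, 5] s s' ∧ s'.reg 4 = q + j ∧
      s'.reg 6 = j ∧
      (∀ w < n, s'.mem 4 w = s.mem 4 w -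
        if s.mem 3 (u * n + w) ≠ 0 ∧ s.mem 3 (u * n + w) ≤ j then 1 else 0) ∧
      (∀ k < q, s'.mem 5 k = s.mem 5 k) ∧
      (∀ k < j, s'.mem 5 (q + k) = s.mem 2 (u * n + k)) ∧ t ≤ 50 * j) ?_ ?_ ?_
  · refine ⟨Same.refl _ _ _, by simp [h4], h6, fun w hw => ?_, by simp, by simp, by simp⟩
    rw [if_neg (by omega)]; rfl
  · rintro j hj s' t ⟨S, e4, e6, ec, el, el', ht⟩
    have e7 : s'.reg 7 = u := by rw [S.1 7 (by decide), h7]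
    have e2 : s'.reg 2 = n := by rw [S.1 2 (by decide), h2]
    have m1 : s'.mem 1 = s.mem 1 := S.2 1 (by decide)
    have m2 : s'.mem 2 = s.mem 2 := S.2 2 (by decide)
    obtain ⟨hA, hP⟩ := R.entry u hu j hj
    have hidx := B.idx u hu j (by omega)
    have hmul := B.mul hu
    have hcA : s'.mem 4 (s.mem 2 (u * n + j)) ≤ n := by
      rw [ec _ hA]; have := hc _ hA; omega
    simp [e7, e2, e6, m1, m2, e4, hj]
    constructorm* _ ∧ _
    any_goals omega
    · constructor
      · intro x hx
        simp at hx
        simp [hx, S.1 x (by simp [hx])]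
      · intro a ha
        simp at ha
        simp [ha, S.2 a (by simp [ha])]
    · intro w hw
      by_cases e : w = s.mem 2 (u * n + j)
      · subst e
        rw [Function.update_self, ec _ hw, hP]
        simp
      · rw [Function.update_of_ne e, ec w hw]
        have : s.mem 3 (u * n + w) ≠ j + 1 := by
          intro h
          have := (R.pos u hu w hw (by omega)).2
          rw [h] at this
          exact e this.symm
        congr 1
        apply if_congr _ rfl rfl
        omega
    · intro k hk
      rw [Function.update_of_ne (by omega), el k hk]
    · intro k hk
      rcases Nat.lt_or_eq_of_le hk with h | rfl
      · rw [Function.update_of_ne (by omega), el' k h]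
      · rw [Function.update_self]
  · rintro s' t ⟨S, e4, e6, ec, el, el', ht⟩
    have e7 : s'.reg 7 = u := by rw [S.1 7 (by decide), h7]
    have m1 : s'.mem 1 = s.mem 1 := S.2 1 (by decide)
    refine ⟨by simp [e7, e6, m1]; omega, by simp [e7, e6, m1], S, e4, fun w hw => ?_, el, el',
      by simp; omega⟩
    rw [ec w hw]
    congr 1
    apply if_congr _ rfl rfl
    constructor
    · exact fun h => h.1
    · exact fun h => ⟨h, (R.pos u hu w hw h).1⟩

theorem count_spec {W n u : ℕ} {s : State} (B : Big n W)
    (R : Rows n (s.mem 1) (s.mem 2) (s.mem 3)) (hc : ∀ w < n, s.mem 4 w ≤ n)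
    (h2 : s.reg 2 = n) (h6 : s.reg 6 = 0) (h7 : s.reg 7 = u) (hu : u < n) :
    Does W countCode s fun s' t => Same [6, 8] [4] s s' ∧
      (∀ w < n, s'.mem 4 w = s.mem 4 w + if s.mem 3 (u * n + w) ≠ 0 then 1 else 0) ∧
      t ≤ 50 * s.mem 1 u + 10 := by
  have hD := R.deg_le hu
  have hW := B.lin
  refine does_loop (s.mem 1 u) (fun j s' t => Same [6, 8] [4] s s' ∧ s'.reg 6 = j ∧
      (∀ w < n, s'.mem 4 w = s.mem 4 w +
        if s.mem 3 (u * n + w) ≠ 0 ∧ s.mem 3 (u * n + w) ≤ j then 1 else 0) ∧ t ≤ 50 * j) ?_ ?_ ?_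
  · refine ⟨Same.refl _ _ _, h6, fun w hw => ?_, by simp⟩
    rw [if_neg (by omega)]; rfl
  · rintro j hj s' t ⟨S, e6, ec, ht⟩
    have e7 : s'.reg 7 = u := by rw [S.1 7 (by decide), h7]
    have e2 : s'.reg 2 = n := by rw [S.1 2 (by decide), h2]
    have m1 : s'.mem 1 = s.mem 1 := S.2 1 (by decide)
    have m2 : s'.mem 2 = s.mem 2 := S.2 2 (by decide)
    obtain ⟨hA, hP⟩ := R.entry u hu j hj
    have hidx := B.idx u hu j (by omega)
    have hmul := B.mul hu
    have hcA : s'.mem 4 (s.mem 2 (u * n + j)) ≤ n := by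
      rw [ec _ hA, if_neg (by omega)]; exact hc _ hA
    simp [e7, e2, e6, m1, m2, hj]
    constructorm* _ ∧ _
    any_goals omega
    · constructor
      · intro x hx
        simp at hx
        simp [hx, S.1 x (by simp [hx])]
      · intro a ha
        simp at ha
        simp [ha, S.2 a (by simp [ha])]
    · intro w hw
      by_cases e : w = s.mem 2 (u * n + j)
      · subst e
        rw [Function.update_self, ec _ hw, hP]
        simp
      · rw [Function.update_of_ne e, ec w hw]
        have : s.mem 3 (u * n + w) ≠ j + 1 := by
          intro h
          have := (R.pos u hu w hw (by omega)).2
          rw [h] at this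
          exact e this.symm
        congr 1
        apply if_congr _ rfl rfl
        omega
  · rintro s' t ⟨S, e6, ec, ht⟩
    have e7 : s'.reg 7 = u := by rw [S.1 7 (by decide), h7]
    have m1 : s'.mem 1 = s.mem 1 := S.2 1 (by decide)
    refine ⟨by simp [e7, e6, m1]; omega, by simp [e7, e6, m1], S, fun w hw => ?_, by simp; omega⟩
    rw [ec w hw]
    congr 1
    apply if_congr _ rfl rfl
    constructor
    · exact fun h => h.1
    · exact fun h => ⟨h, (R.pos u hu w hw h).1⟩

theorem link_spec {W n u v : ℕ} {s : State} (B : Big n W)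
    (R : Rows n (s.mem 1) (s.mem 2) (s.mem 3)) (h2 : s.reg 2 = n) (h7 : s.reg 7 = u)
    (h8 : s.reg 8 = v) (hu : u < n) (hv : v < n) (hP : s.mem 3 (u * n + v) = 0) :
    Does W linkCode s fun s' t => Same [] [1, 2, 3] s s' ∧
      s'.mem 1 = Function.update (s.mem 1) u (s.mem 1 u + 1) ∧
      s'.mem 2 = Function.update (s.mem 2) (u * n + s.mem 1 u) v ∧
      s'.mem 3 = Function.update (s.mem 3) (u * n + v) (s.mem 1 u + 1) ∧ t ≤ 100 := by
  have hD := R.deg_lt hu hv hP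
  have hW := B.lin
  have i1 := B.idx u hu v hv.le
  have i2 := B.idx u hu _ hD.le
  have i3 := B.mul hu
  simp [linkCode, h2, h7, h8]
  constructorm* _ ∧ _
  any_goals omega
  constructor
  · intro x _
    simp
  · intro a ha
    simp at ha
    simp [ha]

theorem unlink_spec {W n u v : ℕ} {s : State} (B : Big n W)
    (R : Rows n (s.mem 1) (s.mem 2) (s.mem 3)) (h2 : s.reg 2 = n) (h7 : s.reg 7 = u)
    (h8 : s.reg 8 = v) (hu : u < n) (hv : v < n) (hP : s.mem 3 (u * n + v) ≠ 0) :
    Does W unlinkCode s fun s' t => Same [6, 10] [1, 2, 3] s s' ∧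
      s'.mem 1 = Function.update (s.mem 1) u (s.mem 1 u - 1) ∧
      s'.mem 2 = Function.update (s.mem 2) (u * n + (s.mem 3 (u * n + v) - 1))
        (s.mem 2 (u * n + (s.mem 1 u - 1))) ∧
      s'.mem 3 = Function.update (Function.update (s.mem 3)
        (u * n + s.mem 2 (u * n + (s.mem 1 u - 1))) (s.mem 3 (u * n + v))) (u * n + v) 0 ∧
      t ≤ 100 := by
  have hD := R.deg_le hu
  have hW := B.lin
  have hp := (R.pos u hu v hv hP).1
  have hw := (R.entry u hu (s.mem 1 u - 1) (by omega)).1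
  have i1 := B.idx u hu v hv.le
  have i2 := B.idx u hu (s.mem 1 u - 1) (by omega)
  have i3 := B.mul hu
  have i4 := B.idx u hu _ hw.le
  have i5 := B.idx u hu (s.mem 3 (u * n + v) - 1) (by omega)
  simp [unlinkCode, h2, h7, h8]
  constructorm* _ ∧ _
  any_goals omega
  constructor
  · intro x hx
    simp at hx
    simp [hx]
  · intro a ha
    simp at ha
    simp [ha]

/-- The position table doubles as an adjacency matrix, so each pair takes constant time. Each round
resets register `10` to `0` or `1`, so the accumulated disjunction stays a word. -/
theorem conflict_spec {W n x j : ℕ} {s : State} (B : Big n W)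
    (R : Rows n (s.mem 1) (s.mem 2) (s.mem 3)) (h2 : s.reg 2 = n) (h5 : s.reg 5 = j)
    (h6 : s.reg 6 = 0) (h7 : s.reg 7 = x) (hx : x < n) (h10 : s.reg 10 ≤ n) (hj : j ≤ n)
    (hl : ∀ k < j, s.mem 5 k < n) (ho : ∀ k < j, s.mem 0 (s.mem 5 k) ≤ 1) :
    Does W conflictCode s fun s' t => Same [6, 8, 10] [] s s' ∧
      (s'.reg 10 = 0 ↔ s.reg 10 = 0 ∧
        ∀ k < j, s.mem 0 (s.mem 5 k) = 0 ∨ s.mem 3 (x * n + s.mem 5 k) = 0) ∧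
      s'.reg 10 < W ∧ t ≤ 50 * j + 10 := by
  have hW := B.lin
  refine does_loop j (fun i s' t => Same [6, 8, 10] [] s s' ∧ s'.reg 6 = i ∧ s'.reg 10 ≤ n ∧
      (s'.reg 10 = 0 ↔ s.reg 10 = 0 ∧
        ∀ k < i, s.mem 0 (s.mem 5 k) = 0 ∨ s.mem 3 (x * n + s.mem 5 k) = 0) ∧
      t ≤ 50 * i) ?_ ?_ ?_
  · exact ⟨Same.refl _ _ _, h6, h10, by simp, by simp⟩
  · rintro i hi s' t ⟨S, e6, e10, er, ht⟩
    have e7 : s'.reg 7 = x := by rw [S.1 7 (by decide), h7]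
    have e5 : s'.reg 5 = j := by rw [S.1 5 (by decide), h5]
    have e2 : s'.reg 2 = n := by rw [S.1 2 (by decide), h2]
    have m : s'.mem = s.mem := by funext a; exact S.2 a (by simp)
    have hw := hl i hi
    have hP : s.mem 3 (x * n + s.mem 5 i) ≤ n := by
      by_cases e : s.mem 3 (x * n + s.mem 5 i) = 0
      · omega
      · exact (R.pos x hx _ hw e).1.trans (R.deg_le hx)
    have i1 := B.idx x hx _ hw.le
    have i2 := B.mul hx
    have ho' := ho i hi
    have hmul : s.mem 0 (s.mem 5 i) * s.mem 3 (x * n + s.mem 5 i) ≤ n := by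
      calc _ ≤ 1 * n := Nat.mul_le_mul ho' hP
        _ = n := one_mul n
    have key : (∀ k < i + 1, s.mem 0 (s.mem 5 k) = 0 ∨ s.mem 3 (x * n + s.mem 5 k) = 0) ↔
        (∀ k < i, s.mem 0 (s.mem 5 k) = 0 ∨ s.mem 3 (x * n + s.mem 5 k) = 0) ∧
        s.mem 0 (s.mem 5 i) * s.mem 3 (x * n + s.mem 5 i) = 0 := by
      rw [mul_eq_zero]
      exact Nat.forall_lt_succ_right
    rw [key]
    set a := s.mem 0 (s.mem 5 i) * s.mem 3 (x * n + s.mem 5 i) with ha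
    have hif : (if 0 < s'.reg 10 + a then 1 else 0) ≤ 1 := by split_ifs <;> omega
    simp only [block_cons, block_one, does_seq, does_set, Expr.Fits, Expr.eval, Op.eval, Expr.cost,
      setReg_reg, setReg_mem, e7, e5, e6, e2, m, hi, ↓reduceIte, Nat.reduceEqDiff, ← ha]
    constructorm* _ ∧ _
    any_goals omega
    any_goals exact True.intro
    all_goals clear_value a
    · constructor
      · intro y hy
        simp at hy
        simp [setReg_reg, hy, S.1 y (by simp [hy])]
      · intro b _
        simp [m]
    · rw [← and_assoc, ← er]
      by_cases hz : 0 < s'.reg 10 + a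
      · simp only [hz, if_true]; omega
      · simp only [hz, if_false, true_iff]; omega
  · rintro s' t ⟨S, e6, e10, er, ht⟩
    have e5 : s'.reg 5 = j := by rw [S.1 5 (by decide), h5]
    exact ⟨by simp [e6, e5]; omega, by simp [e6, e5], S, er, by omega, by simp; omega⟩

/-! ### The potential and the phases of an update -/

/-- The potential that a vertex with state `b` contributes, where `τ` bounds the degree of a vertex
at the time when it is selected. -/
def vertexPot (τ : ℕ) (D : ℕ → ℕ) (x b : ℕ) : ℕ := if b = 1 then 400 * (D x - τ) else 200 * D x

def pot (n τ : ℕ) (D st : ℕ → ℕ) : ℕ := ∑ x ∈ range n, vertexPot τ D x (st x)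

theorem pot_update {n u : ℕ} (hu : u < n) (τ : ℕ) (D st : ℕ → ℕ) (b : ℕ) :
    pot n τ D (Function.update st u b) + vertexPot τ D u (st u) =
      pot n τ D st + vertexPot τ D u b :=
  sum_update_le hu (vertexPot τ D) st b

/-- The potential does not distinguish marked from free vertices, so unmarking is free of charge. -/
theorem pot_congr {n τ : ℕ} {D st st' : ℕ → ℕ} (h : ∀ x < n, st x = 1 ↔ st' x = 1) :
    pot n τ D st = pot n τ D st' := by
  unfold pot vertexPot
  exact sum_congr rfl fun x hx => by simp only [h x (mem_range.1 hx)]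

theorem Base.m_le {n m : ℕ} {D A P c st : ℕ → ℕ} (B : Base n m D A P c st) : m ≤ n * n := by
  have h : ∑ u ∈ range n, D u ≤ n * n := by
    refine (sum_le_card_nsmul _ _ n fun u hu => ?_).trans (by simp)
    exact B.rows.deg_le (mem_range.1 hu)
  have := B.sum
  omega

/-- The invariants that hold between the phases that handle an update. -/
structure Mid (n m q : ℕ) (s : State) : Prop where
  inv : Inv n m 0 q 0 (s.mem 1) (s.mem 2) (s.mem 3) (s.mem 4) (s.mem 5) (s.mem 6)
  out : ∀ x < n, s.mem 0 x = s.mem 6 x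
  reg_n : s.reg 2 = n
  reg_m : s.reg 3 = m
  reg_q : s.reg 4 = q

theorem reset_spec {W n m q h : ℕ} {s : State} (B : Big n W)
    (I : Inv n m q q h (s.mem 1) (s.mem 2) (s.mem 3) (s.mem 4) (s.mem 5) (s.mem 6))
    (ho : ∀ x < n, s.mem 6 x ≠ 2 → s.mem 0 x = s.mem 6 x)
    (h2 : s.reg 2 = n) (h3 : s.reg 3 = m) (h4 : s.reg 4 = h) :
    Does W resetCode s fun s' t => Same [5, 7] [0, 6] s s' ∧ Mid n m h s' ∧
      (∀ x < n, s.mem 6 x = 1 ↔ s'.mem 6 x = 1) ∧ t ≤ 50 * h + 20 := by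
  have hW := B.lin
  have hn := I.h_le_n
  simp only [resetCode, block_cons, block_one, does_seq, does_set, Expr.Fits, Expr.eval, Expr.cost]
  refine ⟨by omega, does_loop h (fun j s' t => Same [5, 7] [0, 6] s s' ∧ s'.reg 5 = j ∧
      (∀ x < n, s'.mem 6 x = if ∃ k < j, s.mem 5 k = x then 0 else s.mem 6 x) ∧
      (∀ x < n, s'.mem 0 x = if ∃ k < j, s.mem 5 k = x then 0 else s.mem 0 x) ∧
      t ≤ 50 * j) ?_ ?_ ?_⟩
  · refine ⟨⟨fun x hx => ?_, fun a _ => rfl⟩, by simp, by simp, by simp, by simp⟩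
    simp at hx
    simp [hx]
  · rintro j hj s' t ⟨S, e5, e6, e0, ht⟩
    have e4 : s'.reg 4 = h := by rw [S.1 4 (by decide), h4]
    have m5 : s'.mem 5 = s.mem 5 := S.2 5 (by decide)
    have hw := (I.marked j hj).1
    have aux : ∀ f g : ℕ → ℕ, (∀ x < n, f x = if ∃ k < j, s.mem 5 k = x then 0 else g x) →
        ∀ x < n, Function.update f (s.mem 5 j) 0 x =
          if ∃ k < j + 1, s.mem 5 k = x then 0 else g x := by
      intro f g hf x hx
      by_cases e : x = s.mem 5 j
      · subst e
        rw [Function.update_self, if_pos ⟨j, by omega, rfl⟩]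
      · rw [Function.update_of_ne e, hf x hx]
        apply if_congr _ rfl rfl
        constructor
        · rintro ⟨k, h1, h2⟩; exact ⟨k, by omega, h2⟩
        · rintro ⟨k, h1, rfl⟩
          exact ⟨k, by have : k ≠ j := fun h => e (by rw [h]); omega, rfl⟩
    have a6 := aux _ _ e6
    have a0 := aux _ _ e0
    simp [e4, e5, m5, hj]
    constructorm* _ ∧ _
    any_goals omega
    · constructor
      · intro x hx
        simp at hx
        simp [hx, S.1 x (by simp [hx])]
      · intro a ha
        simp at ha
        simp [ha, S.2 a (by simp [ha])]
    · simpa using a6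
    · simpa using a0
  · rintro s' t ⟨S, e5, e6, e0, ht⟩
    have e4 : s'.reg 4 = h := by rw [S.1 4 (by decide), h4]
    have hst : ∀ x < n, s'.mem 6 x = if s.mem 6 x = 2 then 0 else s.mem 6 x := by
      intro x hx
      rw [e6 x hx]
      apply if_congr _ rfl rfl
      constructor
      · rintro ⟨k, h1, rfl⟩; exact (I.marked k h1).2
      · exact I.mem_marked x hx
    refine ⟨by simp [e4, e5]; omega, by simp [e4, e5], S, ⟨?_, fun x hx => ?_, ?_, ?_, e4⟩,
      fun x hx => ?_, by simp; omega⟩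
    · rw [S.2 1 (by decide), S.2 2 (by decide), S.2 3 (by decide), S.2 4 (by decide),
        S.2 5 (by decide)]
      exact I.reset hst
    · rw [e6 x hx, e0 x hx]
      by_cases hk : ∃ k < h, s.mem 5 k = x
      · rw [if_pos hk, if_pos hk]
      · rw [if_neg hk, if_neg hk]
        exact ho x hx fun h2 => hk (I.mem_marked x hx h2)
    · rw [S.1 2 (by decide), h2]
    · rw [S.1 3 (by decide), h3]
    · rw [hst x hx]
      by_cases h2 : s.mem 6 x = 2 <;> simp [h2]

/-- Each list entry is charged `100` in advance for its later examination. Deselecting a vertex of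
degree `d` thus costs about `150 d`, while the potential falls by `400 (d - τ) - 200 d`, which is at
least `200 d - 400 τ`. -/
theorem evict_spec {W n m q u τ : ℕ} {s : State} (B : Big n W) (M : Mid n m q s)
    (h7 : s.reg 7 = u) (hu : u < n) (hq : q ≤ 3 * n) :
    Does W evictCode s fun s' t => Same [4, 6, 8] [0, 4, 5, 6] s s' ∧ ∃ q', Mid n m q' s' ∧
      q' ≤ q + n + 1 ∧ s'.mem 6 = Function.update (s.mem 6) u 0 ∧
      t + 100 * q' + pot n τ (s.mem 1) (s'.mem 6) ≤
        100 * q + pot n τ (s.mem 1) (s.mem 6) + 400 * τ + 300 := by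
  have hW := B.lin
  have hD := M.inv.base.rows.deg_le hu
  obtain ⟨I, hout, h2, h3, h4⟩ := M
  have hst := I.st_le_one hu
  have hpot := pot_update hu τ (s.mem 1) (s.mem 6) 0
  by_cases hs : s.mem 6 u = 1
  · have hspec := uncount_spec (s := s.setReg 6 0) (u := u) (q := q) B I.base.rows
      (fun w hw => by
        have := dom_le n (s.mem 3) (s.mem 6) w
        have h := I.base.cnt w hw
        simp only [setReg_mem]
        omega) (by simpa using h2) (by simpa using h4) (by simp) (by simpa using h7) hu hq
    simp [evictCode, h7, hs]
    refine ⟨by omega, by omega, hspec.mono ?_⟩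
    rintro s' t ⟨S, e4, ec, el, el', ht⟩
    simp at ht e4 el el'
    have e7 : s'.reg 7 = u := by rw [S.1 7 (by decide)]; simpa using h7
    have m0 : s'.mem 0 = s.mem 0 := S.2 0 (by decide)
    have m1 : s'.mem 1 = s.mem 1 := S.2 1 (by decide)
    have m2 : s'.mem 2 = s.mem 2 := S.2 2 (by decide)
    have m3 : s'.mem 3 = s.mem 3 := S.2 3 (by decide)
    have m6 : s'.mem 6 = s.mem 6 := S.2 6 (by decide)
    have hI := I.evict hu hs (c' := s'.mem 4)
      (l' := Function.update (s'.mem 5) (q + s.mem 1 u) u)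
      ec
      (fun j hj => by rw [Function.update_of_ne (by omega), el j hj])
      (fun j hj => by rw [Function.update_of_ne (by omega), el' j hj]) (by simp)
    simp only [vertexPot, hs, if_true] at hpot
    simp [e7, e4, m6]
    constructorm* _ ∧ _
    any_goals omega
    · constructor
      · intro x hx
        simp at hx
        simp [hx, S.1 x (by simp [hx])]
      · intro a ha
        simp at ha
        simp [ha, S.2 a (by simp [ha])]
    · refine ⟨q + s.mem 1 u + 1, ⟨?_, fun x hx => ?_, ?_, ?_, ?_⟩, by omega, ?_⟩
      · simp [m1, m2, m3, m6]
        exact hI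
      · by_cases e : x = u
        · subst e; simp
        · simp [e, m0, m6, hout x hx]
      · simp [S.1 2, h2]
      · simp [S.1 3, h3]
      · simp
      · simp at hpot
        omega
  · have hs0 : s.mem 6 u = 0 := by omega
    have hI := I.push hu (l' := Function.update (s.mem 5) q u)
      (fun j hj => by rw [Function.update_of_ne (by omega)]) (by simp)
    simp [evictCode, h7, hs0, h4]
    constructorm* _ ∧ _
    any_goals omega
    · constructor
      · intro x hx
        simp at hx
        simp [hx]
      · intro a ha
        simp at ha
        simp [ha]
    · exact ⟨q + 1, ⟨by simpa using hI, by simpa using hout, by simpa using h2, by simpa using h3,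
        by simp⟩, by omega, by omega⟩

/-- The invariants of the loop over the work list. -/
structure Proc (n m i q h : ℕ) (s : State) : Prop where
  inv : Inv n m i q h (s.mem 1) (s.mem 2) (s.mem 3) (s.mem 4) (s.mem 5) (s.mem 6)
  out : ∀ x < n, s.mem 0 x = if s.mem 6 x = 1 then 1 else 0
  reg_n : s.reg 2 = n
  reg_m : s.reg 3 = m
  reg_h : s.reg 4 = h

/-- Marking and skipping take constant time and keep the potential. A selected vertex is light, so
`d ≤ τ` and its potential falls from `200 d` to `0`, which covers the `50 d` steps of counting. -/
theorem examine_spec {W n m i q h τ : ℕ} {s : State} (B : Big n W) (M : Proc n m i q h s)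
    (hτ : ∀ d, d * d * d ≤ m * m → d ≤ τ) (h7 : s.reg 7 = s.mem 5 i) (hi : i < q) :
    Does W examineCode s fun s' t => Same [4, 6, 8] [0, 4, 5, 6] s s' ∧
      (∃ h', Proc n m (i + 1) q h' s') ∧
      t + pot n τ (s.mem 1) (s'.mem 6) ≤ pot n τ (s.mem 1) (s.mem 6) + 70 := by
  have hW := B.lin
  obtain ⟨I, hout, h2, h3, h4⟩ := M
  have hu := I.pending_lt i le_rfl hi
  have hh := I.h_le_n
  set u := s.mem 5 i with hudef
  have hD := I.base.rows.deg_le hu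
  have hst := I.le_two u hu
  have hc : ∀ w < n, s.mem 4 w ≤ n := fun w hw => by
    have := dom_le n (s.mem 3) (s.mem 6) w
    have := I.base.cnt w hw
    omega
  have hcu := hc u hu
  have hsq := B.sq m I.base.m_le
  have hm := B.edges I.base.m_le
  have hD2 := B.square hD
  have hD3 := B.cube _ hD
  by_cases hz : s.mem 6 u + s.mem 4 u = 0
  · have hs0 : s.mem 6 u = 0 := by omega
    have hc0 : s.mem 4 u = 0 := by omega
    by_cases hheavy : m * m < s.mem 1 u * s.mem 1 u * s.mem 1 u
    · have hI := I.advance_mark hi hs0 hheavy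
      have hpot := pot_update hu τ (s.mem 1) (s.mem 6) 2
      simp [vertexPot, hs0] at hpot
      simp [examineCode, h7, h3, h4, hs0, hc0, hheavy]
      constructorm* _ ∧ _
      any_goals omega
      · constructor
        · intro x hx
          simp at hx
          simp [hx]
        · intro a ha
          simp at ha
          simp [ha]
      · refine ⟨h + 1, by simpa using hI, fun x hx => ?_, by simpa using h2, by simpa using h3,
          by simp⟩
        by_cases e : x = u
        · simp [e, hout u hu, hs0]
        · simp [e, hout x hx]
    · have hle := hτ _ (not_lt.1 hheavy)
      have hpot := pot_update hu τ (s.mem 1) (s.mem 6) 1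
      have e0 : s.mem 1 u - τ = 0 := by omega
      simp [vertexPot, hs0, e0] at hpot
      simp only [examineCode, block_cons, block_one, does_cond, does_seq, does_store, does_set,
        does_skip, Expr.Fits, Expr.eval, Op.eval, Expr.cost, setMem_reg, h7, h3, hs0, hc0, hheavy,
        if_false]
      refine ⟨⟨⟨by omega, by omega⟩, ⟨by omega, by omega⟩, by omega⟩, fun h => absurd rfl h,
        fun _ => ⟨⟨⟨by omega, by omega, by omega⟩, ⟨⟨⟨by omega, by omega⟩, ⟨by omega, by omega⟩,
        by omega⟩, ⟨by omega, by omega⟩, by omega⟩, by omega⟩, fun h => absurd rfl h, fun _ =>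
        ⟨by omega, by omega, by omega, by omega, by omega, ?_⟩⟩⟩
      refine (count_spec (u := u) B (by simpa using I.base.rows) (by simpa using hc)
        (by simpa using h2) (by simp) (by simpa using h7) hu).mono ?_
      rintro s' t ⟨S, ec, ht⟩
      have m0 := S.2 0 (by decide)
      have m1 := S.2 1 (by decide)
      have m2 := S.2 2 (by decide)
      have m3 := S.2 3 (by decide)
      have m5 := S.2 5 (by decide)
      have m6 := S.2 6 (by decide)
      simp at m0 m1 m2 m3 m5 m6 ht
      have hI := I.advance_add hi hs0 hc0 (c' := s'.mem 4) ec
      refine ⟨⟨fun x hx => ?_, fun a ha => ?_⟩, ⟨h, ?_, fun x hx => ?_, ?_, ?_, ?_⟩, ?_⟩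
      · rw [S.1 x (fun hx' => hx (by simp at hx' ⊢; tauto))]
        simp at hx
        simp [hx]
      · rw [S.2 a (fun ha' => ha (by simp at ha' ⊢; tauto))]
        simp at ha
        simp [ha]
      · rw [m1, m2, m3, m5, m6]
        exact hI
      · rw [m0, m6]
        by_cases e : x = u
        · subst e
          simp
        · simp [e, hout x hx]
      · rw [S.1 2 (by decide)]; simpa using h2
      · rw [S.1 3 (by decide)]; simpa using h3
      · rw [S.1 4 (by decide)]; simpa using h4
      · rw [m6]
        omega
  · have hI := I.advance_skip (by rw [← hudef]; omega)
    simp only [examineCode, does_cond, does_skip, Expr.Fits, Expr.eval, Op.eval, Expr.cost, h7]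
    refine ⟨⟨⟨by omega, by omega⟩, ⟨by omega, by omega⟩, by omega⟩, fun _ =>
      ⟨Same.refl _ _ _, ⟨h, hI, hout, h2, h3, h4⟩, by omega⟩, fun h => absurd h hz⟩

theorem process_spec {W n m q τ : ℕ} {s : State} (B : Big n W) (M : Mid n m q s)
    (hτ : ∀ d, d * d * d ≤ m * m → d ≤ τ) (hq : q < W) :
    Does W processCode s fun s' t => Same [4, 5, 6, 7, 8, 9] [0, 4, 5, 6] s s' ∧
      (∃ h, Proc n m q q h s') ∧
      t + pot n τ (s.mem 1) (s'.mem 6) ≤ 100 * q + pot n τ (s.mem 1) (s.mem 6) + 20 := by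
  have hW := B.lin
  simp only [processCode, block_cons, block_one, does_seq, does_set, Expr.Fits, Expr.eval,
    Expr.cost, M.reg_q]
  refine ⟨hq, by omega, by omega, does_loop q (fun j s' t =>
    Same [4, 5, 6, 7, 8, 9] [0, 4, 5, 6] s s' ∧ s'.reg 5 = j ∧ s'.reg 9 = q ∧
    (∃ h, Proc n m j q h s') ∧
    t + pot n τ (s.mem 1) (s'.mem 6) ≤ 100 * j + pot n τ (s.mem 1) (s.mem 6)) ?_ ?_ ?_⟩
  · refine ⟨⟨fun x hx => ?_, fun _ _ => rfl⟩, by simp, by simp, ⟨0, M.inv, fun x hx => ?_,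
      by simpa using M.reg_n, by simpa using M.reg_m, by simp⟩, by simp⟩
    · simp at hx
      simp [hx]
    · have h1 := M.inv.st_le_one hx
      have h2 := M.out x hx
      change s.mem 0 x = if s.mem 6 x = 1 then 1 else 0
      split_ifs <;> omega
  · rintro j hj s' t ⟨S, e5, e9, ⟨h, P⟩, ht⟩
    have hl := P.inv.pending_lt j le_rfl hj
    simp only [does_seq, does_set, Expr.Fits, Expr.eval, Op.eval,
      Expr.cost, e5, e9, hj, if_true]
    refine ⟨⟨by omega, hq, by omega⟩, by omega, ⟨by omega, by omega⟩, ?_⟩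
    have m1 : s'.mem 1 = s.mem 1 := S.2 1 (by decide)
    refine (examine_spec (s := s'.setReg 7 (s'.mem 5 j)) (τ := τ) (i := j) (h := h) B ⟨by simpa using P.inv, P.out,
      by simpa using P.reg_n, by simpa using P.reg_m, by simpa using P.reg_h⟩ hτ
      (by simp) hj).mono ?_
    rintro s'' t' ⟨S', ⟨h', P'⟩, ht'⟩
    have e5' : s''.reg 5 = j := by rw [S'.1 5 (by decide)]; simpa using e5
    have e9' : s''.reg 9 = q := by rw [S'.1 9 (by decide)]; simpa using e9
    simp only [setReg_mem, m1] at ht'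
    refine ⟨⟨by omega, by omega, by omega⟩, ⟨fun x hx => ?_, fun a ha => ?_⟩, by simp [e5'],
      by simpa using e9', ⟨h', P'.inv, P'.out, by simpa using P'.reg_n, by simpa using P'.reg_m,
      by simpa using P'.reg_h⟩, ?_⟩
    · have h1 := S'.1 x (fun hx' => hx (by simp at hx' ⊢; tauto))
      have h2 := S.1 x hx
      simp at hx
      simp [hx] at h1
      simp [hx, h1, h2]
    · exact (S'.2 a ha).trans (S.2 a ha)
    · simp only [setReg_mem]
      omega
  · rintro s' t ⟨S, e5, e9, P, ht⟩
    refine ⟨by simp [e5, e9]; omega, by simp [e5, e9], S, P, by simp; omega⟩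

/-- The work list is exhausted, so each unmarked vertex is selected or has a selected neighbour. A
marked vertex joins the output iff it has neither a selected neighbour (its counter is zero) nor an
earlier marked neighbour in the output; rejection therefore exhibits a neighbour in the output. -/
theorem greedy_spec {W n m q h : ℕ} {s : State} (B : Big n W) (M : Proc n m q q h s) :
    Does W greedyCode s fun s' t => Same [5, 6, 7, 8, 10] [0] s s' ∧
      (∀ x < n, s.mem 6 x ≠ 2 → s'.mem 0 x = s.mem 6 x) ∧
      (∀ x < n, ∀ y < n, s'.mem 0 x = 1 → s'.mem 0 y = 1 → s.mem 3 (x * n + y) = 0) ∧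
      (∀ x < n, s'.mem 0 x = 1 ∨ ∃ y < n, s'.mem 0 y = 1 ∧ s.mem 3 (x * n + y) ≠ 0) ∧
      t ≤ 50 * (h * h) + 100 * h + 20 := by
  have hW := B.lin
  obtain ⟨I, hout, h2, h3, h4⟩ := M
  have hh := I.h_le_n
  have R := I.base.rows
  simp only [greedyCode, block_cons, block_one, does_seq, does_set, Expr.Fits, Expr.eval,
    Expr.cost]
  refine ⟨by omega, does_loop h (fun j s' t => Same [5, 6, 7, 8, 10] [0] s s' ∧ s'.reg 5 = j ∧
      (∀ x < n, s'.mem 0 x ≤ 1) ∧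
      (∀ x < n, s.mem 6 x ≠ 2 → s'.mem 0 x = s.mem 6 x) ∧
      (∀ k, j ≤ k → k < h → s'.mem 0 (s.mem 5 k) = 0) ∧
      (∀ x < n, ∀ y < n, s'.mem 0 x = 1 → s'.mem 0 y = 1 → s.mem 3 (x * n + y) = 0) ∧
      (∀ k < j, s'.mem 0 (s.mem 5 k) = 1 ∨
        ∃ y < n, s'.mem 0 y = 1 ∧ s.mem 3 (s.mem 5 k * n + y) ≠ 0) ∧
      t ≤ (50 * h + 100) * j) ?_ ?_ ?_⟩
  · have h1 : ∀ x < n, s.mem 0 x = 1 → s.mem 6 x = 1 := by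
      intro x hx h
      rw [hout x hx] at h
      by_contra hne
      simp [hne] at h
    refine ⟨⟨fun x hx => ?_, fun a _ => rfl⟩, by simp, fun x hx => ?_, fun x hx h2 => ?_,
      fun k _ hk => ?_, fun x hx y hy a b => I.base.indep x hx y hy (h1 x hx a) (h1 y hy b),
      by simp, by simp⟩
    · simp at hx
      simp [hx]
    · simp only [setReg_mem]
      rw [hout x hx]
      split_ifs <;> omega
    · have := I.le_two x hx
      simp only [setReg_mem]
      rw [hout x hx]
      split_ifs <;> omega
    · simp [hout _ (I.marked k hk).1, (I.marked k hk).2]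
  · rintro j hj s' t ⟨S, e5, o1, o2, o3, o4, o5, ht⟩
    obtain ⟨hx, hx2⟩ := I.marked j hj
    have e4 : s'.reg 4 = h := by rw [S.1 4 (by decide), h4]
    have e2 : s'.reg 2 = n := by rw [S.1 2 (by decide), h2]
    have m1 : s'.mem 1 = s.mem 1 := S.2 1 (by decide)
    have m2 : s'.mem 2 = s.mem 2 := S.2 2 (by decide)
    have m3 : s'.mem 3 = s.mem 3 := S.2 3 (by decide)
    have m4 : s'.mem 4 = s.mem 4 := S.2 4 (by decide)
    have m5 : s'.mem 5 = s.mem 5 := S.2 5 (by decide)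
    set x := s.mem 5 j with hxdef
    have hcx : s.mem 4 x ≤ n := by
      rw [I.base.cnt x hx]
      exact dom_le _ _ _ _
    simp only [does_seq, does_set, Expr.Fits, Expr.eval, Op.eval,
      Expr.cost, e4, e5, m4, m5, hj, if_true, setReg_mem, setReg_reg, ← hxdef]
    refine ⟨⟨by omega, by omega, by omega⟩, by omega, ⟨by omega, by omega⟩,
      ⟨by omega, by omega⟩, by omega, ?_⟩
    refine (conflict_spec (x := x) (j := j) B (by simpa [m1, m2, m3] using R) (by simpa using e2)
      (by simpa using e5) (by simp) (by simp) hx (by simpa using hcx) (by omega)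
      (fun k hk => by simpa [m5] using (I.marked k (by omega)).1)
      (fun k hk => by simpa [m5] using o1 _ (I.marked k (by omega)).1)).mono ?_
    rintro s'' t' ⟨S', er, hr, ht'⟩
    simp [m3, m5] at er
    have em : s''.mem = s'.mem := by funext a; simpa using S'.2 a (by simp)
    have e5' : s''.reg 5 = j := by rw [S'.1 5 (by decide)]; simpa using e5
    have e7' : s''.reg 7 = x := by rw [S'.1 7 (by decide)]; simp
    have hreg : ∀ y, y ∉ [5, 6, 7, 8, 10] → s''.reg y = s.reg y := by
      intro y hy
      have h1 := S'.1 y (fun hy' => hy (by simp at hy' ⊢; tauto))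
      have h2 := S.1 y hy
      simp at hy
      simp [hy] at h1
      rw [h1, h2]
    have hmem : ∀ a, a ∉ [0] → s'.mem a = s.mem a := S.2
    have htime : (50 * h + 100) * (j + 1) = (50 * h + 100) * j + 50 * h + 100 := by ring
    simp only [does_cond, does_skip, does_store, Expr.Fits, Expr.eval, Expr.cost,
      setMem_reg, e5', e7']
    refine ⟨hr, fun h0 => ⟨⟨by omega, by omega, by omega⟩, ⟨fun y hy => ?_, fun a ha => ?_⟩,
      by simp, ?_, ?_, ?_, ?_, ?_, ?_⟩, fun h0 => ⟨by omega, by omega, ⟨by omega, by omega,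
      by omega⟩, ⟨fun y hy => ?_, fun a ha => ?_⟩, by simp, ?_, ?_, ?_, ?_, ?_, ?_⟩⟩
    · have := hreg y hy
      simp at hy
      simp [hy, this]
    · simp [em, hmem a ha]
    · simpa [em] using o1
    · simpa [em] using o2
    · intro k h1 h2
      simpa [em] using o3 k (by omega) h2
    · simpa [em] using o4
    · intro k hk
      simp only [em]
      rcases Nat.lt_succ_iff_lt_or_eq.1 hk with hk | rfl
      · exact o5 k hk
      · right
        -- A rejected vertex with zero counter conflicts with an earlier marked vertex; a positive
        -- counter gives a selected neighbour.
        by_cases hc : s.mem 4 x = 0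
        · have hex : ∃ i < k, s'.mem 0 (s.mem 5 i) ≠ 0 ∧ s.mem 3 (x * n + s.mem 5 i) ≠ 0 := by
            by_contra hcon
            push Not at hcon
            exact h0 (er.2 ⟨hc, fun i hi => or_iff_not_imp_left.2 (hcon i hi)⟩)
          obtain ⟨i, hi, h1, h2⟩ := hex
          have hi' := (I.marked i (by omega)).1
          exact ⟨_, hi', by have := o1 _ hi'; omega, h2⟩
        · rw [I.base.cnt x hx] at hc
          obtain ⟨y, hy, h1, h2⟩ := exists_of_dom hc
          exact ⟨y, hy, by rw [o2 y hy (by omega), h1], h2⟩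
    · rw [htime]
      omega
    · have := hreg y hy
      simp at hy
      simp [hy, this]
    · have := hmem a ha
      simp at ha
      simp [em, ha, this]
    all_goals
      obtain ⟨hc, hno⟩ := er.1 h0
    · intro y hy
      by_cases e : y = x
      · simp [e]
      · simpa [e, em] using o1 y hy
    · intro y hy h2
      have e : y ≠ x := by
        rintro rfl
        exact h2 hx2
      simpa [e, em] using o2 y hy h2
    · intro k h1 h2
      have e : s.mem 5 k ≠ x := fun e => by
        have := I.inj k h2 j hj e
        omega
      simpa [e, em] using o3 k (by omega) h2
    · have hfree : ∀ y < n, s'.mem 0 y = 1 → s.mem 3 (x * n + y) = 0 := by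
        intro y hy h1
        by_cases h2 : s.mem 6 y = 2
        · obtain ⟨k, hk, rfl⟩ := I.mem_marked y hy h2
          rcases Nat.lt_or_ge k j with hkj | hkj
          · rcases hno k hkj with h | h
            · omega
            · exact h
          · have := o3 k hkj hk
            omega
        · rw [o2 y hy h2] at h1
          exact dom_eq_zero (by rw [← I.base.cnt x hx, hc]) hy h1
      intro y hy z hz
      by_cases ey : y = x <;> by_cases ez : z = x
      · subst ey; subst ez
        intro _ _
        exact I.base.irrefl _ hx
      · subst ey
        simp only [setMem_mem, if_true, Function.update_of_ne ez, em]
        exact fun _ h => hfree z hz h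
      · subst ez
        simp only [setMem_mem, if_true, Function.update_of_ne ey, em]
        intro h _
        by_contra hP
        exact I.base.symm _ hy _ hz hP (hfree y hy h)
      · simp only [setMem_mem, if_true, Function.update_of_ne ey,
          Function.update_of_ne ez, em]
        exact o4 y hy z hz
    · intro k hk
      rcases Nat.lt_succ_iff_lt_or_eq.1 hk with hk | rfl
      · have hup : ∀ y, s'.mem 0 y = 1 → Function.update (s'.mem 0) x 1 y = 1 := by
          intro y hy
          by_cases e : y = x
          · simp [e]
          · rwa [Function.update_of_ne e]
        simp only [setMem_mem, if_true, em]
        rcases o5 k hk with h | ⟨y, hy, h1, h2⟩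
        · exact Or.inl (hup _ h)
        · exact Or.inr ⟨y, hy, hup _ h1, h2⟩
      · left
        simp [← hxdef]
    · rw [htime]
      omega
  · rintro s' t ⟨S, e5, o1, o2, o3, o4, o5, ht⟩
    have e4 : s'.reg 4 = h := by rw [S.1 4 (by decide), h4]
    refine ⟨by simp [e4, e5]; omega, by simp [e4, e5], S, o2, o4, fun x hx => ?_, ?_⟩
    · have hle := I.le_two x hx
      have ho := o2 x hx
      by_cases h2 : s.mem 6 x = 2
      · obtain ⟨k, hk, rfl⟩ := I.mem_marked x hx h2
        exact o5 k hk
      · by_cases h1 : s.mem 6 x = 1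
        · left; rw [ho h2, h1]
        · right
          have hc : s.mem 4 x ≠ 0 := by
            intro hc
            obtain ⟨k, a, b, -⟩ := I.pending x hx (by omega) hc
            omega
          rw [I.base.cnt x hx] at hc
          obtain ⟨y, hy, a, b⟩ := exists_of_dom hc
          exact ⟨y, hy, by rw [o2 y hy (by omega), a], b⟩
    · have : (50 * h + 100) * h = 50 * (h * h) + 100 * h := by ring
      simp
      omega

/-! ### Thresholds: few heavy vertices, slowly varying potential -/

/-- The integer part of the cube root. -/
def cbrt (m : ℕ) : ℕ := Nat.findGreatest (fun t => t ^ 3 ≤ m) m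

theorem cbrt_le (m : ℕ) : cbrt m ^ 3 ≤ m :=
  Nat.findGreatest_spec (P := fun t => t ^ 3 ≤ m) (Nat.zero_le m) (by simp)

theorem lt_cbrt (m : ℕ) : m < (cbrt m + 1) ^ 3 := by
  by_contra h
  push Not at h
  have h1 : cbrt m + 1 ≤ m := (Nat.le_self_pow (by norm_num) _).trans h
  have := Nat.le_findGreatest (P := fun t => t ^ 3 ≤ m) h1 h
  unfold cbrt at this
  omega

theorem cbrt_le_of_le_succ {m m' : ℕ} (h : m ≤ m' + 1) : cbrt m ≤ cbrt m' + 1 := by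
  by_contra hlt
  have h1 : cbrt m' + 2 ≤ cbrt m := by omega
  have h2 := Nat.pow_le_pow_left h1 3
  have h3 := cbrt_le m
  have h4 := lt_cbrt m'
  nlinarith

/-- A bound for the degrees of vertices at the time when they are selected. -/
def thr (m : ℕ) : ℕ := (cbrt m + 1) ^ 2

/-- With `T = cbrt m`, `m < (T + 1) ^ 3` gives `d ^ 3 ≤ m ^ 2 < (T + 1) ^ 6 = thr m ^ 3`. -/
theorem le_thr {m d : ℕ} (h : d * d * d ≤ m * m) : d ≤ thr m := by
  by_contra hlt
  push Not at hlt
  have h1 := lt_cbrt m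
  have h2 : thr m ^ 3 < d ^ 3 := Nat.pow_lt_pow_left hlt (by norm_num)
  have h3 : m ^ 2 < ((cbrt m + 1) ^ 3) ^ 2 := Nat.pow_lt_pow_left h1 (by norm_num)
  have h4 : thr m ^ 3 = ((cbrt m + 1) ^ 3) ^ 2 := by unfold thr; ring
  nlinarith

theorem lt_of_heavy {m d : ℕ} (h : m * m < d * d * d) : cbrt m ^ 2 + 1 ≤ d := by
  by_contra hlt
  have h1 : d ≤ cbrt m ^ 2 := by omega
  have h2 := Nat.pow_le_pow_left h1 3
  have h3 := Nat.pow_le_pow_left (cbrt_le m) 2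
  have h4 : (cbrt m ^ 2) ^ 3 = (cbrt m ^ 3) ^ 2 := by ring
  nlinarith

/-- Markov's inequality for degrees; it bounds both the number of marked vertices and the number of
vertices affected by a change of threshold. -/
theorem card_mul_le (n d : ℕ) (D : ℕ → ℕ) :
    #{x ∈ range n | d ≤ D x} * d ≤ ∑ x ∈ range n, D x := by
  rw [← smul_eq_mul]
  exact (card_nsmul_le_sum _ _ _ fun x hx => (mem_filter.1 hx).2).trans
    (sum_le_sum_of_subset (filter_subset _ _))

/-- With `T = cbrt m`, marked vertices are distinct and of degree at least `T ^ 2 + 1`, so `h * (T ^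
2 + 1) ≤ 2 * m < 2 * (T + 1) ^ 3`; then `(T + 1) ^ 2 ≤ 2 * (T ^ 2 + 1)`. -/
theorem Inv.h_le_cbrt {n m i q h : ℕ} {D A P c l st : ℕ → ℕ} (I : Inv n m i q h D A P c l st) :
    h ≤ 4 * (cbrt m + 1) := by
  have h1 : h ≤ #{x ∈ range n | cbrt m ^ 2 + 1 ≤ D x} := by
    rw [← card_range h]
    refine card_le_card_of_injOn l (fun j hj => ?_) fun j hj j' hj' e => ?_
    · simp at hj ⊢
      obtain ⟨a, b⟩ := I.marked j hj
      exact ⟨a, lt_of_heavy (I.heavy _ a b)⟩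
    · simp at hj hj'; exact I.inj j hj j' hj' e
  have h2 := card_mul_le n (cbrt m ^ 2 + 1) D
  rw [I.base.sum] at h2
  have h3 := lt_cbrt m
  have h4 : h * (cbrt m ^ 2 + 1) ≤ 2 * m := (Nat.mul_le_mul_right _ h1).trans h2
  generalize cbrt m = T at *
  by_contra hlt
  push Not at hlt
  have h5 : 4 * (T + 1) * (T ^ 2 + 1) ≤ h * (T ^ 2 + 1) := Nat.mul_le_mul_right _ hlt.le
  have h6 : (T + 1) ^ 2 ≤ 2 * (T ^ 2 + 1) := by nlinarith [two_mul_le_add_sq T 1]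
  have h7 := Nat.mul_le_mul_left (T + 1) h6
  nlinarith

/-- The unselected endpoints gain at most `200` each. A lower threshold raises the potential only at
selected vertices of degree at least `thr m'`. With `T = cbrt m'` there are at most `2 (T + 1)` of
these, and the threshold drops by at most `2 T + 3`, so the total increase is again of order `T ^
2`. -/
theorem pot_modify {n m m' u v : ℕ} {D D' st : ℕ → ℕ} (hu : u < n) (hv : v < n)
    (hD : ∀ x < n, D' x ≤ D x + (if x = u then 1 else 0) + if x = v then 1 else 0)
    (hst : ∀ x < n, st x = 1 → D' x = D x) (hsum : ∑ x ∈ range n, D' x = 2 * m')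
    (hm : m ≤ m' + 1) :
    pot n (thr m') D' st ≤ pot n (thr m) D st + 2800 * thr m' := by
  have h1 : pot n (thr m') D' st ≤ ∑ x ∈ range n, (vertexPot (thr m) D x (st x) +
      ((if x = u then 200 else 0) + (if x = v then 200 else 0) +
        if thr m' ≤ D' x then 400 * (thr m - thr m') else 0)) := by
    refine sum_le_sum fun x hx => ?_
    have a := hD x (mem_range.1 hx)
    have b := hst x (mem_range.1 hx)
    unfold vertexPot
    split_ifs at * <;> omega
  rw [sum_add_distrib, sum_add_distrib, sum_add_distrib, sum_ite_eq', sum_ite_eq',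
    if_pos (mem_range.2 hu), if_pos (mem_range.2 hv), ← sum_filter, sum_const, smul_eq_mul] at h1
  have h2 := card_mul_le n (thr m') D'
  rw [hsum] at h2
  change _ ≤ pot n (thr m) D st + _ at h1
  set k := #{x ∈ range n | thr m' ≤ D' x}
  have h3 := lt_cbrt m'
  have h4 := cbrt_le_of_le_succ hm
  have h5 : k ≤ 2 * (cbrt m' + 1) := by
    unfold thr at h2
    by_contra hlt
    push Not at hlt
    have := Nat.mul_le_mul_right ((cbrt m' + 1) ^ 2) hlt.le
    nlinarith
  have h6 : thr m - thr m' ≤ 2 * cbrt m' + 3 := by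
    have : thr m ≤ (cbrt m' + 2) ^ 2 := Nat.pow_le_pow_left (by omega) 2
    have e : (cbrt m' + 2) ^ 2 = (cbrt m' + 1) ^ 2 + (2 * cbrt m' + 3) := by ring
    unfold thr at *
    omega
  have h7 : k * (400 * (thr m - thr m')) ≤
      2 * (cbrt m' + 1) * (400 * (2 * cbrt m' + 3)) :=
    Nat.mul_le_mul h5 (Nat.mul_le_mul_left _ h6)
  -- The constant `2800` is attained at `cbrt m' = 0`.
  have h8 : 400 + 2 * (cbrt m' + 1) * (400 * (2 * cbrt m' + 3)) ≤ 2800 * thr m' := by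
    unfold thr
    nlinarith [Nat.zero_le (cbrt m')]
  omega

/-! ### Changing an edge -/

/-- Between `s` and `s'`, entry `(a, b)` is added to the adjacency rows if `i = 1`, and removed if
`i = 0`. -/
structure RowChange (n a b i : ℕ) (s s' : State) : Prop where
  same : Same [6, 10] [1, 2, 3] s s'
  rows : Rows n (s'.mem 1) (s'.mem 2) (s'.mem 3)
  adj : ∀ x < n, ∀ y < n, s'.mem 3 (x * n + y) ≠ 0 ↔
    if x = a ∧ y = b then i = 1 else s.mem 3 (x * n + y) ≠ 0
  deg : ∃ d, s'.mem 1 = Function.update (s.mem 1) a d ∧ d + (1 - i) = s.mem 1 a + i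

/-- The code `half` performs a row change with parameter `i`. -/
def IsHalf (W n i : ℕ) (half : Cmd) : Prop :=
  ∀ (s : State) (a b : ℕ), Rows n (s.mem 1) (s.mem 2) (s.mem 3) → s.reg 2 = n → s.reg 7 = a →
    s.reg 8 = b → a < n → b < n → (s.mem 3 (a * n + b) ≠ 0 ↔ i = 0) →
    Does W half s fun s' t => RowChange n a b i s s' ∧ t ≤ 100

theorem isHalf_link {W n : ℕ} (B : Big n W) : IsHalf W n 1 linkCode := by
  intro s a b R h2 h7 h8 ha hb hP
  have hP : s.mem 3 (a * n + b) = 0 := by simpa using hP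
  refine (link_spec B R h2 h7 h8 ha hb hP).mono ?_
  rintro s' t ⟨S, m1, m2, m3, ht⟩
  refine ⟨⟨S.mono (by simp) (by simp), ?_, fun x hx y hy => ?_, _, m1, rfl⟩, ht⟩
  · rw [m1, m2, m3]; exact R.link ha hb hP
  · rw [m3]
    by_cases e : x = a ∧ y = b
    · obtain ⟨rfl, rfl⟩ := e
      simp
    · rw [if_neg e, Function.update_of_ne fun h => e (idx_inj hy hb h)]

theorem isHalf_unlink {W n : ℕ} (B : Big n W) : IsHalf W n 0 unlinkCode := by
  intro s a b R h2 h7 h8 ha hb hP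
  have hP : s.mem 3 (a * n + b) ≠ 0 := by simpa using hP
  have hp := (R.pos a ha b hb hP).1
  have hw := R.entry a ha (s.mem 1 a - 1) (by omega)
  refine (unlink_spec B R h2 h7 h8 ha hb hP).mono ?_
  rintro s' t ⟨S, m1, m2, m3, ht⟩
  refine ⟨⟨S, ?_, fun x hx y hy => ?_, _, m1, by omega⟩, ht⟩
  · rw [m1, m2, m3]; exact R.unlink ha hb hP
  · rw [m3]
    by_cases e : x = a ∧ y = b
    · obtain ⟨rfl, rfl⟩ := e
      simp
    · rw [if_neg e, Function.update_of_ne fun h => e (idx_inj hy hb h)]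
      by_cases e' : x * n + y = a * n + s.mem 2 (a * n + (s.mem 1 a - 1))
      · rw [e', Function.update_self, hw.2]
        simpa using hP
      · rw [Function.update_of_ne e']

/-- The code `count` adds (`i = 1`) or subtracts (`i = 0`) one in register `3`. -/
def IsCount (W i : ℕ) (count : Cmd) : Prop :=
  ∀ (s : State) (m m' : ℕ), s.reg 3 = m → m < W → m' < W → m' + (1 - i) = m + i →
    Does W count s fun s' t => s' = s.setReg 3 m' ∧ t ≤ 10

theorem isCount_incr {W : ℕ} (hW : 1 < W) : IsCount W 1 (incr 3) := by
  intro s m m' h3 hm hm' e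
  have e' : m + 1 = m' := by omega
  simp [h3, hm, hm', hW, e']

theorem isCount_decr {W : ℕ} (hW : 1 < W) : IsCount W 0 (.set 3 (minus (var 3) (kst 1))) := by
  intro s m m' h3 hm hm' e
  have e' : m - 1 = m' := by omega
  simp [h3, hm, hm', hW, e']

theorem sum_update_add {n u : ℕ} (hu : u < n) (D : ℕ → ℕ) (d : ℕ) :
    ∑ x ∈ range n, Function.update D u d x + D u = ∑ x ∈ range n, D x + d :=
  sum_update_le hu (fun _ b => b) D d

/-- Both endpoints are unselected at this moment, so neither counters nor independence are affected.
The parameter `i` treats insertion (`1`) and deletion (`0`) together. -/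
theorem edge_spec {W n m q u v i : ℕ} {s : State} {half count : Cmd} (B : Big n W)
    (hhalf : IsHalf W n i half) (hcount : IsCount W i count) (hi : i ≤ 1) (M : Mid n m q s)
    (h0 : s.reg 0 = u) (h1 : s.reg 1 = v) (hu : u < n) (hv : v < n) (huv : u ≠ v)
    (hP : s.mem 3 (u * n + v) ≠ 0 ↔ i = 0) (hsu : s.mem 6 u ≠ 1) (hsv : s.mem 6 v ≠ 1) :
    Does W (edgeCode half count) s fun s' t => ∃ m', m' + (1 - i) = m + i ∧ Mid n m' q s' ∧
      (∀ x < n, ∀ y < n, s'.mem 3 (x * n + y) ≠ 0 ↔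
        if (x = u ∧ y = v) ∨ (x = v ∧ y = u) then i = 1 else s.mem 3 (x * n + y) ≠ 0) ∧
      pot n (thr m') (s'.mem 1) (s'.mem 6) ≤
        pot n (thr m) (s.mem 1) (s.mem 6) + 2800 * thr m' ∧ t ≤ 300 := by
  obtain ⟨I, hout, h2, h3, h4⟩ := M
  have hW := B.lin
  have Bs := I.base
  have hP' : s.mem 3 (v * n + u) ≠ 0 ↔ i = 0 := by
    rw [← hP]
    exact ⟨Bs.symm _ hv _ hu, Bs.symm _ hu _ hv⟩
  simp only [edgeCode, block_cons, block_one, does_seq, does_set, Expr.Fits, Expr.eval, Expr.cost,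
    h0, h1, setReg_reg, Nat.reduceEqDiff, if_false]
  refine ⟨by omega, by omega, ?_⟩
  refine (hhalf _ u v (by simpa using Bs.rows) (by simpa using h2) (by simp) (by simp) hu hv
    (by simpa using hP)).mono ?_
  rintro s₁ t₁ ⟨⟨S₁, R₁, adj₁, d₁, D₁, hd₁⟩, ht₁⟩
  simp only [setReg_mem] at adj₁ D₁ hd₁
  have r0 : s₁.reg 0 = u := by rw [S₁.1 0 (by decide)]; simpa using h0
  have r1 : s₁.reg 1 = v := by rw [S₁.1 1 (by decide)]; simpa using h1
  simp only [r0, r1]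
  refine ⟨by omega, by omega, ?_⟩
  refine (hhalf _ v u (by simpa using R₁) ?_ (by simp) (by simp) hv hu ?_).mono ?_
  · have := S₁.1 2 (by decide)
    simpa [h2] using this
  · simp only [setReg_mem]
    rw [adj₁ v hv u hu, if_neg (fun h => huv h.2), hP']
  rintro s₂ t₂ ⟨⟨S₂, R₂, adj₂, d₂, D₂, hd₂⟩, ht₂⟩
  simp only [setReg_mem] at adj₂ D₂ hd₂
  rw [D₁, Function.update_of_ne huv.symm] at hd₂
  have sum₁ := sum_update_add hu (s.mem 1) d₁
  have sum₂ := sum_update_add hv (s₁.mem 1) d₂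
  rw [← D₁] at sum₁
  rw [← D₂] at sum₂
  have e1 : s₁.mem 1 v = s.mem 1 v := by rw [D₁, Function.update_of_ne huv.symm]
  rw [e1] at sum₂
  have hsum := Bs.sum
  -- For a deletion `hd₁` makes the degree of `u` positive, hence `m ≥ 1`, and the subtraction in
  -- the witness is not truncated.
  obtain ⟨m', hm', hS⟩ : ∃ m', m' + (1 - i) = m + i ∧ ∑ x ∈ range n, s₂.mem 1 x = 2 * m' :=
    ⟨m + i - (1 - i), by omega, by omega⟩
  have adj : ∀ x < n, ∀ y < n, s₂.mem 3 (x * n + y) ≠ 0 ↔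
      if (x = u ∧ y = v) ∨ (x = v ∧ y = u) then i = 1 else s.mem 3 (x * n + y) ≠ 0 := by
    intro x hx y hy
    rw [adj₂ x hx y hy]
    by_cases e2 : x = v ∧ y = u
    · rw [if_pos e2, if_pos (Or.inr e2)]
    · rw [if_neg e2, adj₁ x hx y hy]
      by_cases e1 : x = u ∧ y = v
      · rw [if_pos e1, if_pos (Or.inl e1)]
      · rw [if_neg e1, if_neg (not_or.2 ⟨e1, e2⟩)]
  have reg : ∀ x, x ∉ [6, 7, 8, 10] → s₂.reg x = s.reg x := by
    intro x hx
    have a₂ := (S₂.mono (R' := [6, 7, 8, 10]) (by simp) fun _ h => h).1 x hx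
    have a₁ := (S₁.mono (R' := [6, 7, 8, 10]) (by simp) fun _ h => h).1 x hx
    simp at hx
    simp [hx] at a₁ a₂
    rw [a₂, a₁]
  have mem : ∀ a, a ∉ [1, 2, 3] → s₂.mem a = s.mem a := fun a ha =>
    (S₂.2 a ha).trans (S₁.2 a ha)
  have Bs' : Base n m' (s₂.mem 1) (s₂.mem 2) (s₂.mem 3) (s.mem 4) (s.mem 6) := by
    refine Bs.modify hsu hsv R₂ (fun x hx y hy => ?_) (fun x hx => ?_) (fun x hx y hy a b => ?_) hS
    · rw [adj x hx y hy, adj y hy x hx]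
      by_cases e : x = u ∧ y = v ∨ x = v ∧ y = u
      · rw [if_pos e, if_pos (e.symm.imp And.symm And.symm)]
        exact id
      · rw [if_neg e, if_neg fun e' => e (e'.symm.imp And.symm And.symm)]
        exact Bs.symm x hx y hy
    · have h := adj x hx x hx
      rw [if_neg (by rintro (⟨a, b⟩ | ⟨a, b⟩); exacts [huv (a.symm.trans b), huv (b.symm.trans a)])]
        at h
      by_contra hne
      exact h.1 hne (Bs.irrefl x hx)
    · rw [adj x hx y hy, if_neg (not_or.2 ⟨a, b⟩)]
  have hdeg : ∀ x, s₂.mem 1 x = if x = v then d₂ else if x = u then d₁ else s.mem 1 x := by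
    intro x
    rw [D₂, Function.update_apply, D₁, Function.update_apply]
  refine (hcount s₂ m m' (by rw [reg 3 (by decide), h3]) (B.edges Bs.m_le) (B.edges Bs'.m_le)
    hm').mono ?_
  rintro s₃ t₃ ⟨rfl, ht₃⟩
  refine ⟨m', hm', ⟨?_, ?_, ?_, by simp, ?_⟩, by simpa using adj, ?_, by omega⟩
  · simp only [setReg_mem, mem 4 (by decide), mem 5 (by decide), mem 6 (by decide)]
    exact I.modify Bs'
  · simpa only [setReg_mem, mem 0 (by decide), mem 6 (by decide)] using hout
  · simp [reg 2 (by decide), h2]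
  · simp [reg 4 (by decide), h4]
  · simp only [setReg_mem, mem 6 (by decide)]
    refine pot_modify hu hv (fun x hx => ?_) (fun x hx h => ?_) hS (by omega)
    · rw [hdeg]
      split_ifs <;> subst_vars <;> omega
    · have a : x ≠ v := fun e => hsv (e ▸ h)
      have b : x ≠ u := fun e => hsu (e ▸ h)
      rw [hdeg, if_neg a, if_neg b]

/-! ### A complete update -/

/-- The invariants that hold between updates. -/
structure Rest (n m q h : ℕ) (s : State) : Prop where
  inv : Inv n m q q h (s.mem 1) (s.mem 2) (s.mem 3) (s.mem 4) (s.mem 5) (s.mem 6)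
  out : ∀ x < n, s.mem 6 x ≠ 2 → s.mem 0 x = s.mem 6 x
  indep : ∀ x < n, ∀ y < n, s.mem 0 x = 1 → s.mem 0 y = 1 → s.mem 3 (x * n + y) = 0
  maximal : ∀ x < n, s.mem 0 x = 1 ∨ ∃ y < n, s.mem 0 y = 1 ∧ s.mem 3 (x * n + y) ≠ 0
  reg_n : s.reg 2 = n
  reg_m : s.reg 3 = m
  reg_h : s.reg 4 = h

/-- The left side collects the costs not paid by potential: `50 h` for unmarking and `100 h` for
re-examining, twice `400 * thr m` for the evictions, the greedy phase, and constants. All are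
expressed through the new edge count, as the final bound requires. -/
theorem phase_bound {m m' h h' : ℕ} (hh : h ≤ 4 * (cbrt m + 1)) (hh' : h' ≤ 4 * (cbrt m' + 1))
    (hc : cbrt m ≤ cbrt m' + 1) :
    150 * h + 800 * thr m + 50 * (h' * h') + 100 * h' + 1500 ≤ 8000 * thr m' := by
  have k0 : h ≤ 4 * (cbrt m' + 2) := by omega
  have k1 : thr m ≤ (cbrt m' + 2) ^ 2 := Nat.pow_le_pow_left (by omega) 2
  have k2 : h' * h' ≤ 16 * (cbrt m' + 1) ^ 2 := by
    have := Nat.mul_le_mul hh' hh'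
    nlinarith
  unfold thr at *
  generalize cbrt m' = T at *
  nlinarith

theorem update_spec {W n m q h u v i : ℕ} {s : State} {half count : Cmd} (B : Big n W)
    (hhalf : IsHalf W n i half) (hcount : IsCount W i count) (hi : i ≤ 1) (M : Rest n m q h s)
    (h0 : s.reg 0 = u) (h1 : s.reg 1 = v) (hu : u < n) (hv : v < n) (huv : u ≠ v)
    (hP : s.mem 3 (u * n + v) ≠ 0 ↔ i = 0) :
    Does W (updateCode half count) s fun s' t => ∃ m' q' h', Rest n m' q' h' s' ∧
      (∀ x < n, ∀ y < n, s'.mem 3 (x * n + y) ≠ 0 ↔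
        if (x = u ∧ y = v) ∨ (x = v ∧ y = u) then i = 1 else s.mem 3 (x * n + y) ≠ 0) ∧
      t + pot n (thr m') (s'.mem 1) (s'.mem 6) ≤
        pot n (thr m) (s.mem 1) (s.mem 6) + 12000 * thr m' := by
  have hW := B.lin
  have hhn := M.inv.h_le_n
  have hhc := M.inv.h_le_cbrt
  simp only [updateCode, block_cons, block_one, does_seq, does_set, Expr.Fits, Expr.eval,
    Expr.cost]
  refine (reset_spec B M.inv M.out M.reg_n M.reg_m M.reg_h).mono ?_
  rintro s₁ t₁ ⟨S₁, M₁, p₁, ht₁⟩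
  have a0 : s₁.reg 0 = u := by rw [S₁.1 0 (by decide), h0]
  have a1 : s₁.reg 1 = v := by rw [S₁.1 1 (by decide), h1]
  have a3 : s₁.mem 3 = s.mem 3 := S₁.2 3 (by decide)
  have aD : s₁.mem 1 = s.mem 1 := S₁.2 1 (by decide)
  have hp₁ := pot_congr (τ := thr m) (D := s.mem 1) p₁
  have keep : ∀ {m q : ℕ} {s : State} {b : ℕ}, Mid n m q s → Mid n m q (s.setReg 7 b) :=
    fun M => ⟨M.inv, M.out, M.reg_n, M.reg_m, M.reg_q⟩
  refine ⟨by omega, ?_⟩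
  rw [a0]
  refine (evict_spec (τ := thr m) B (keep M₁) (by simp) hu (by omega)).mono ?_
  rintro s₂ t₂ ⟨S₂, q₂, M₂, hq₂, st₂, ht₂⟩
  simp only [setReg_mem, aD] at st₂ ht₂
  have b0 : s₂.reg 0 = u := by rw [S₂.1 0 (by decide)]; simpa using a0
  have b1 : s₂.reg 1 = v := by rw [S₂.1 1 (by decide)]; simpa using a1
  have b3 : s₂.mem 3 = s.mem 3 := (S₂.2 3 (by decide)).trans a3
  have bD : s₂.mem 1 = s.mem 1 := (S₂.2 1 (by decide)).trans aD
  refine ⟨by omega, ?_⟩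
  rw [b1]
  -- After the first eviction the list has length at most `2 * n + 1`, hence at most `3 * n` because
  -- `u < n`.
  refine (evict_spec (τ := thr m) B (keep M₂) (by simp) hv (by omega)).mono ?_
  rintro s₃ t₃ ⟨S₃, q₃, M₃, hq₃, st₃, ht₃⟩
  simp only [setReg_mem, bD] at st₃ ht₃
  have c0 : s₃.reg 0 = u := by rw [S₃.1 0 (by decide)]; simpa using b0
  have c1 : s₃.reg 1 = v := by rw [S₃.1 1 (by decide)]; simpa using b1
  have c3 : s₃.mem 3 = s.mem 3 := (S₃.2 3 (by decide)).trans b3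
  have cD : s₃.mem 1 = s.mem 1 := (S₃.2 1 (by decide)).trans bD
  refine (edge_spec B hhalf hcount hi M₃ c0 c1 hu hv huv (by rw [c3]; exact hP)
    (by rw [st₃, Function.update_of_ne huv, st₂]; simp) (by rw [st₃]; simp)).mono ?_
  rintro s₄ t₄ ⟨m', hm', M₄, adj, hp₄, ht₄⟩
  rw [c3] at adj
  rw [cD] at hp₄
  refine (process_spec (τ := thr m') B M₄ (fun d => le_thr) (by omega)).mono ?_
  rintro s₅ t₅ ⟨S₅, ⟨h', M₅⟩, ht₅⟩
  have e3 : s₅.mem 3 = s₄.mem 3 := S₅.2 3 (by decide)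
  have eD : s₅.mem 1 = s₄.mem 1 := S₅.2 1 (by decide)
  refine (greedy_spec B M₅).mono ?_
  rintro s₆ t₆ ⟨S₆, o₁, o₂, o₃, ht₆⟩
  have f1 : s₆.mem 1 = s₅.mem 1 := S₆.2 1 (by decide)
  have f2 : s₆.mem 2 = s₅.mem 2 := S₆.2 2 (by decide)
  have f3 : s₆.mem 3 = s₅.mem 3 := S₆.2 3 (by decide)
  have f4 : s₆.mem 4 = s₅.mem 4 := S₆.2 4 (by decide)
  have f5 : s₆.mem 5 = s₅.mem 5 := S₆.2 5 (by decide)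
  have f6 : s₆.mem 6 = s₅.mem 6 := S₆.2 6 (by decide)
  refine ⟨m', q₃, h', ⟨?_, ?_, ?_, ?_, ?_, ?_, ?_⟩, ?_, ?_⟩
  · rw [f1, f2, f3, f4, f5, f6]; exact M₅.inv
  · rw [f6]; exact o₁
  · rw [f3]; exact o₂
  · rw [f3]; exact o₃
  · rw [S₆.1 2 (by decide), M₅.reg_n]
  · rw [S₆.1 3 (by decide), M₅.reg_m]
  · rw [S₆.1 4 (by decide), M₅.reg_h]
  · rw [f3, e3]; exact adj
  · rw [f1, f6, eD]
    have hh' := M₅.inv.h_le_cbrt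
    have hc := cbrt_le_of_le_succ (show m ≤ m' + 1 by omega)
    have hb := phase_bound hhc hh' hc
    omega

/-- In the empty graph all vertices are selected and all degrees vanish, so the zeroed arrays are
already correct and the potential is zero. -/
theorem init_spec {W n : ℕ} (B : Big n W) :
    Does W initCode (State.start n) fun s t => Rest n 0 0 0 s ∧ (∀ x, s.mem 3 x = 0) ∧
      pot n (thr 0) (s.mem 1) (s.mem 6) = 0 ∧ t ≤ 50 * (n + 1) := by
  have hW := B.lin
  simp only [initCode, block_cons, block_one, does_seq, does_set, Expr.Fits, Expr.eval, Expr.cost,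
    State.start, if_true]
  refine ⟨by omega, does_loop n (fun j s t => (∀ x, s.reg x = if x = 2 then n else if x = 5 then j
    else if x = 0 then n else 0) ∧ (∀ x < j, s.mem 0 x = 1 ∧ s.mem 6 x = 1) ∧
    (∀ a x, a ≠ 0 → a ≠ 6 → s.mem a x = 0) ∧ t ≤ 40 * j) ?_ ?_ ?_⟩
  · refine ⟨fun x => ?_, by simp, fun _ _ _ _ => rfl, by simp⟩
    simp only [setReg_reg]
    split_ifs <;> omega
  · rintro j hj s t ⟨hr, hm, h0, ht⟩
    have r2 : s.reg 2 = n := by simp [hr]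
    have r5 : s.reg 5 = j := by simp [hr]
    simp only [does_seq, does_set, does_store, Expr.Fits, Expr.eval, Expr.cost, Op.eval, r2, r5,
      hj, if_true, setMem_reg]
    refine ⟨⟨by omega, by omega, by omega⟩, by omega, by omega, by omega, by omega, by omega,
      ⟨by omega, by omega, by omega⟩, fun x => ?_, fun x hx => ?_, fun a x ha hb => ?_, by omega⟩
    · simp only [setReg_reg, setMem_reg, hr]
      split_ifs <;> omega
    · rcases Nat.lt_succ_iff_lt_or_eq.1 hx with h | rfl
      · simp [h.ne, hm x h]
      · simp
    · simpa [ha, hb] using h0 a x ha hb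
  · rintro s t ⟨hr, hm, h0, ht⟩
    have r2 : s.reg 2 = n := by simp [hr]
    have r5 : s.reg 5 = n := by simp [hr]
    have m6 : ∀ x < n, s.mem 6 x = 1 := fun x hx => (hm x hx).2
    have m0 : ∀ x < n, s.mem 0 x = 1 := fun x hx => (hm x hx).1
    have m1 : ∀ x, s.mem 1 x = 0 := fun x => h0 1 x (by decide) (by decide)
    have m3 : ∀ x, s.mem 3 x = 0 := fun x => h0 3 x (by decide) (by decide)
    have m4 : ∀ x, s.mem 4 x = 0 := fun x => h0 4 x (by decide) (by decide)
    refine ⟨by simp [r2, r5]; omega, by simp [r2, r5], ⟨⟨⟨⟨?_, ?_⟩, ?_, ?_, ?_, ?_, ?_⟩, ?_, le_rfl,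
      ?_, ?_, ?_, ?_, ?_, ?_⟩, ?_, ?_, ?_, r2, ?_, ?_⟩, m3, ?_, by simp; omega⟩
    · simp [m1]
    · simp [m3]
    · simp [m3]
    · simp [m3]
    · simp [m1]
    · simp [m4, dom, m3]
    · simp [m3]
    · intro x hx; simp [m6 x hx]
    · simp
    · simp
    · intro x hx; simp [m6 x hx]
    · intro x hx; simp [m6 x hx]
    · intro x hx; simp [m6 x hx]
    · simp
    · intro x hx; simp [m6 x hx, m0 x hx]
    · simp [m3]
    · intro x hx; simp [m0 x hx]
    · simp [hr]
    · simp [hr]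
    · refine sum_eq_zero fun x hx => ?_
      simp [vertexPot, m1]

/-! ### From arrays to graphs -/

/-- The state represents the graph `G`. -/
def Good {n : ℕ} (G : SimpleGraph (Fin n)) (s : State) : Prop :=
  (∃ m q h, Rest n m q h s) ∧ ∀ u v : Fin n, G.Adj u v ↔ s.mem 3 (u * n + v) ≠ 0

/-- The potential of a state between updates. -/
def State.pot (n : ℕ) (s : State) : ℕ := DynMIS.pot n (thr (s.reg 3)) (s.mem 1) (s.mem 6)

/-- The handshake lemma, compared with the invariant on the stored degree sum. -/
theorem Good.ncard_edgeSet {n : ℕ} {G : SimpleGraph (Fin n)} {s : State} (h : Good G s) :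
    G.edgeSet.ncard = s.reg 3 := by
  classical
  obtain ⟨⟨m, q, k, R⟩, hadj⟩ := h
  have hdeg : ∀ v : Fin n, G.degree v = s.mem 1 v := by
    intro v
    rw [R.inv.base.rows.deg_eq v.2, ← SimpleGraph.card_neighborFinset_eq_degree,
      SimpleGraph.neighborFinset_eq_filter, card_filter, card_filter, sum_range]
    exact sum_congr rfl fun w _ => by simp only [hadj]
  have h1 := G.sum_degrees_eq_twice_card_edges
  have h2 := R.inv.base.sum
  rw [sum_range] at h2
  simp only [hdeg, h2] at h1
  rw [Set.ncard_eq_toFinset_card', R.reg_m]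
  have : G.edgeSet.toFinset.card = G.edgeFinset.card := rfl
  omega

theorem Good.maximal_output {n : ℕ} {G : SimpleGraph (Fin n)} {s : State} (h : Good G s) :
    Maximal G.IsIndepSet (s.output n) := by
  obtain ⟨⟨m, q, k, R⟩, hadj⟩ := h
  refine ⟨fun u hu v hv _ huv => ?_, fun T hT hle v hv => ?_⟩
  · exact (hadj u v).1 huv (R.indep u u.2 v v.2 hu hv)
  · rcases R.maximal v v.2 with h | ⟨y, hy, h1, h2⟩
    · exact h
    · have hyT : (⟨y, hy⟩ : Fin n) ∈ T := hle h1
      have ha : G.Adj v ⟨y, hy⟩ := (hadj v ⟨y, hy⟩).2 h2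
      exact absurd ha (hT hv hyT ha.ne)

theorem Good.step {W n : ℕ} (B : Big n W) {G : SimpleGraph (Fin n)} {s : State} (h : Good G s)
    (up : Update n) (hv : up.Valid G) :
    Does W (misAlgorithm.code up) (s.announce up) fun s' t => Good (up.apply G) s' ∧
      t + s'.pot n ≤ s.pot n + 12000 * thr (up.apply G).edgeSet.ncard := by
  have hW := B.lin
  obtain ⟨⟨m, q, k, R⟩, hadj⟩ := h
  have hann : ∀ u v : ℕ, Rest n m q k ((s.setReg 0 u).setReg 1 v) := fun u v =>
    ⟨R.inv, R.out, R.indep, R.maximal, R.reg_n, R.reg_m, R.reg_h⟩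
  -- The common conclusion for both kinds of update, given that the adjacency of the new graph
  -- follows the same case distinction as the position table.
  have fin : ∀ {G' : SimpleGraph (Fin n)} {s' : State} {t : ℕ} {u v : Fin n} {i : ℕ},
      (∀ x y : Fin n, G'.Adj x y ↔
        if (x = u ∧ y = v) ∨ (x = v ∧ y = u) then i = 1 else G.Adj x y) →
      (∃ m' q' h', Rest n m' q' h' s' ∧
      (∀ x < n, ∀ y < n, s'.mem 3 (x * n + y) ≠ 0 ↔
        if (x = u ∧ y = v) ∨ (x = v ∧ y = u) then i = 1 else s.mem 3 (x * n + y) ≠ 0) ∧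
      t + DynMIS.pot n (thr m') (s'.mem 1) (s'.mem 6) ≤
        DynMIS.pot n (thr m) (s.mem 1) (s.mem 6) + 12000 * thr m') →
      Good G' s' ∧ t + s'.pot n ≤ s.pot n + 12000 * thr G'.edgeSet.ncard := by
    rintro G' s' t u v i hG' ⟨m', q', h', R', hadj', ht⟩
    have hg : Good G' s' := by
      refine ⟨⟨m', q', h', R'⟩, fun x y => ?_⟩
      rw [hG', hadj' x x.2 y y.2]
      simp only [Fin.ext_iff, hadj]
    refine ⟨hg, ?_⟩
    rw [hg.ncard_edgeSet, State.pot, State.pot, R'.reg_m, R.reg_m]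
    exact ht
  cases up with
  | insert u v =>
    obtain ⟨huv, hna⟩ := hv
    refine (update_spec B (isHalf_link B) (isCount_incr (by omega)) le_rfl (hann u v) (by simp)
      (by simp) u.2 v.2 (fun e => huv (Fin.ext e)) ?_).mono fun s' t h => fin (fun x y => ?_) h
    · have : s.mem 3 (u * n + v) = 0 := by
        by_contra hne
        exact hna ((hadj u v).2 hne)
      simp [this]
    · simp only [Update.apply, SimpleGraph.sup_adj, SimpleGraph.edge_adj]
      by_cases e : x = u ∧ y = v ∨ x = v ∧ y = u
      · rw [if_pos e]
        have : x ≠ y := by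
          rintro rfl
          rcases e with ⟨a, b⟩ | ⟨a, b⟩
          · exact huv (a.symm.trans b)
          · exact huv (b.symm.trans a)
        simp [e, this]
      · rw [if_neg e]
        simp [e]
  | delete u v =>
    have hne : u ≠ v := SimpleGraph.Adj.ne hv
    refine (update_spec B (isHalf_unlink B) (isCount_decr (by omega)) (by omega) (hann u v)
      (by simp) (by simp) u.2 v.2 (fun e => hne (Fin.ext e)) ?_).mono
      fun s' t h => fin (fun x y => ?_) h
    · have := (hadj u v).1 hv
      simpa using this
    · simp only [Update.apply, SimpleGraph.deleteEdges_adj, Set.mem_singleton_iff, Sym2.eq_iff]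
      by_cases e : x = u ∧ y = v ∨ x = v ∧ y = u
      · simp [e]
      · simp [e]

/-! ### The rate and the summation over all updates -/

/-- Write `M = max m 2`. Then `thr m ≤ 4 * M ^ (2/3)`, and the logarithmic factor is only used
through `√(log M) ≥ √(log 2) ≥ 1/2`. -/
theorem thr_le_rate (m : ℕ) : (thr m : ℝ) ≤ 8 * rate m := by
  have h1 : ((cbrt m : ℝ)) ^ 2 ≤ ((max m 2 : ℕ) : ℝ) ^ (2 / 3 : ℝ) := by
    have h : ((cbrt m : ℝ)) ^ 3 ≤ ((max m 2 : ℕ) : ℝ) := by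
      exact_mod_cast (cbrt_le m).trans (le_max_left _ _)
    have := Real.rpow_le_rpow (by positivity) h (show (0 : ℝ) ≤ 2 / 3 by norm_num)
    rw [← Real.rpow_natCast, ← Real.rpow_mul (by positivity)] at this
    norm_num at this ⊢
    exact this
  have h2 : (1 : ℝ) ≤ ((max m 2 : ℕ) : ℝ) ^ (2 / 3 : ℝ) :=
    Real.one_le_rpow (by exact_mod_cast (by omega : 1 ≤ max m 2)) (by norm_num)
  have h3 : (1 / 2 : ℝ) ≤ Real.sqrt (Real.log ((max m 2 : ℕ) : ℝ)) := by
    apply Real.le_sqrt_of_sq_le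
    have : Real.log 2 ≤ Real.log ((max m 2 : ℕ) : ℝ) :=
      Real.log_le_log (by norm_num) (by exact_mod_cast le_max_right m 2)
    have := Real.log_two_gt_d9
    norm_num at *
    linarith
  have h4 : (thr m : ℝ) ≤ 4 * ((max m 2 : ℕ) : ℝ) ^ (2 / 3 : ℝ) := by
    have : (thr m : ℝ) = ((cbrt m : ℝ) + 1) ^ 2 := by simp [thr]
    rw [this]
    nlinarith [sq_nonneg ((cbrt m : ℝ) - 1)]
  unfold rate
  nlinarith

theorem graphAt_succ {n : ℕ} (us : List (Update n)) {i : ℕ} (h : i < us.length) :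
    graphAt us (i + 1) = us[i].apply (graphAt us i) := by
  unfold graphAt
  rw [List.take_succ_eq_append_getElem h, List.foldl_append]
  rfl

end DynMIS

open DynMIS in
theorem theorem1 :
    ∃ (A : DynMIS.Algorithm) (k : ℕ) (C : ℝ),
      ∀ (n : ℕ) (us : List (DynMIS.Update n)), DynMIS.ValidSeq us →
        ∃ (st : ℕ → DynMIS.State) (t₀ : ℕ) (t : ℕ → ℕ),
          DynMIS.Run ((n + 2) ^ k) A.init (DynMIS.State.start n) (st 0) t₀ ∧
          (t₀ : ℝ) ≤ C * ((n : ℝ) + 1) ∧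
          (∀ (i : ℕ) (h : i < us.length),
            DynMIS.Run ((n + 2) ^ k) (A.code us[i]) ((st i).announce us[i]) (st (i + 1)) (t i)) ∧
          (∀ i ≤ us.length,
            Maximal (DynMIS.graphAt us i).IsIndepSet ((st i).output n)) ∧
          (∑ i ∈ Finset.range us.length, (t i : ℝ)) ≤
            C * ∑ i ∈ Finset.range us.length,
              DynMIS.rate (DynMIS.graphAt us (i + 1)).edgeSet.ncard := by
  -- `96000 = 12000 * 8`, from `Good.step` and `thr_le_rate`.
  refine ⟨misAlgorithm, 6, 96000, fun n us hus => ?_⟩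
  have B := big_pow n
  obtain ⟨s₀, t₀, hrun, hrest, hP, hpot, ht₀⟩ := init_spec B
  have good₀ : Good (graphAt us 0) s₀ := by
    refine ⟨⟨0, 0, 0, hrest⟩, fun u v => ?_⟩
    simp [graphAt, hP]
  -- The successor is defined for every index and state, with a dummy value where no step is
  -- guaranteed, so that `choose` and recursion yield the whole run.
  have hstep : ∀ (i : ℕ) (s : State), ∃ (s' : State) (t : ℕ), ∀ (h : i < us.length),
      Good (graphAt us i) s → Run ((n + 2) ^ 6) (misAlgorithm.code us[i]) (s.announce us[i]) s' t ∧
        Good (graphAt us (i + 1)) s' ∧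
        t + s'.pot n ≤ s.pot n + 12000 * thr (graphAt us (i + 1)).edgeSet.ncard := by
    intro i s
    by_cases h : i < us.length ∧ Good (graphAt us i) s
    · obtain ⟨hi, hg⟩ := h
      obtain ⟨s', t, h1, h2, h3⟩ := hg.step B us[i] (hus i hi)
      rw [← graphAt_succ us hi] at h2 h3
      exact ⟨s', t, fun _ _ => ⟨h1, h2, h3⟩⟩
    · exact ⟨s, 0, fun h1 h2 => absurd ⟨h1, h2⟩ h⟩
  choose next time hnext using hstep
  let st : ℕ → State := fun i => Nat.rec s₀ (fun i s => next i s) i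
  have good : ∀ i ≤ us.length, Good (graphAt us i) (st i) := by
    intro i
    induction i with
    | zero => exact fun _ => good₀
    | succ i ih => exact fun hi => (hnext i (st i) hi (ih (by omega))).2.1
  -- The amortized bounds telescope from the initial potential zero.
  have total : ∀ k ≤ us.length, ∑ i ∈ Finset.range k, time i (st i) + (st k).pot n ≤
      12000 * ∑ i ∈ Finset.range k, thr (graphAt us (i + 1)).edgeSet.ncard := by
    intro k
    induction k with
    | zero =>
      intro _
      have : (st 0).pot n = 0 := by
        change State.pot n s₀ = 0
        rw [State.pot, hrest.reg_m, hpot]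
      simp [this]
    | succ k ih =>
      intro hk
      have h1 := ih (by omega)
      have h2 := (hnext k (st k) hk (good k (by omega))).2.2
      change time k (st k) + (st (k + 1)).pot n ≤ _ at h2
      rw [Finset.sum_range_succ, Finset.sum_range_succ, mul_add]
      omega
  refine ⟨st, t₀, fun i => time i (st i), hrun, ?_, fun i hi =>
    (hnext i (st i) hi (good i hi.le)).1, fun i hi => (good i hi).maximal_output, ?_⟩
  · have : (t₀ : ℝ) ≤ 50 * ((n : ℝ) + 1) := by exact_mod_cast ht₀
    have hn : (0 : ℝ) ≤ n := Nat.cast_nonneg n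
    linarith
  · have h1 : ∑ i ∈ Finset.range us.length, time i (st i) ≤
        12000 * ∑ i ∈ Finset.range us.length, thr (graphAt us (i + 1)).edgeSet.ncard :=
      (Nat.le_add_right _ _).trans (total _ le_rfl)
    have h2 : (∑ i ∈ Finset.range us.length, (time i (st i) : ℝ)) ≤
        12000 * ∑ i ∈ Finset.range us.length, (thr (graphAt us (i + 1)).edgeSet.ncard : ℝ) := by
      exact_mod_cast h1
    refine h2.trans ?_
    rw [Finset.mul_sum, Finset.mul_sum]
    refine Finset.sum_le_sum fun i _ => ?_
    have := thr_le_rate (graphAt us (i + 1)).edgeSet.ncard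
    linarith
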